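/- **Theorem 4.** Let $N\ge 2$, $\tau\ge1$, $M\ge1$ be integers and $a,\mu,C,L>0$, $V,R$ real numbers. *Network.* For every $t\ge0$ let $\mathbf A(t)=[A_{i,j}(t)]$ be a doubly stochastic $N\times N$ matrix (nonnegative entries) whose nonzero entries are all at least $a$ and whose diagonal entries are nonzero, and suppose that for every $t_0\ge 0$ the directed graph on $\{1,\dots,N\}$ with edge set $\bigcup_{t=t_0}^{t_0+\tau-1}\{(i,j):A_{i,j}(t)\neq0\}$ is strongly connected. *Costs.* Let $\mathcal K\subseteq\mathbb R^M$ be convex with $\mathbf 0\in\mathcal K$ and $\|\theta\|\le R$ for all $\theta\in\mathcal K$. For each node $i$ let $\xi_{i,1},\xi_{i,2},\dots$ be random elements of a measurable space $\mathcal S_i$, all with the same law, and let $F_i:\mathcal K\times\mathcal S_i\to\mathbb R$ be measurable with $|F_i|\le C$. Put $f_i(\theta)=\mathbb E[F_i(\theta;\xi_{i,1})]$ and $f=\frac1N\sum_{i=1}^N f_i$ on $\mathcal K$. Assume that $f$ is $\mu$-strongly convex on $\mathcal K$, that each $f_i$ is differentiable on $\mathcal K$ with $\|\nabla f_i(\theta)-\nabla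 f_i(\theta')\|\le L_i\|\theta-\theta'\|$ for all $\theta,\theta'\in\mathcal K$, and that $L=\frac1N\sum_{i=1}^N L_i$. Let $\theta^*$ be a minimizer of $f$ on $\mathcal K$. *Constants.* Put $$\rho=2\,\frac{1+a^{(N-1)\tau}}{1-a^{(N-1)\tau}},\qquad \eta=\bigl(1-a^{(N-1)\tau}\bigr)^{\frac1{(N-1)\tau}},\qquad \kappa=2^{\frac74}+N\rho\,\frac{10-7\eta}{4(1-\eta)^2},$$ $$\lambda_{\mathsf I}=\sqrt{NM^3}\,V^2L,\qquad \lambda_{\mathsf{II}}=2L\sqrt{NM}\,VC\kappa,\qquad \lambda_{\mathsf{III}}=2NMV^2C^2(\kappa^2+1),$$ $$\Psi^*=\max\Bigl\{4\sqrt6\,NR^2\Bigl(\lambda_{\mathsf I}+\frac{\lambda_{\mathsf I}\lambda_{\mathsf{II}}}{6\mu\sqrt{\lambda_{\mathsf{III}}}}\Bigr)^{-2},\ \frac{\sqrt{6\lambda_{\mathsf{III}}}}{\lambda_{\mathsf I}\mu^2}\Bigr\},$$ $$\alpha_t=\frac3\mu t^{-1},\qquad \beta_0=\bigl(6\lambda_{\mathsf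 I}^{-2}\lambda_{\mathsf{III}}\bigr)^{\frac14},\qquad \beta_t=\beta_0t^{-\frac14}\quad(t\ge1).$$ (Under the network hypothesis $a\le\frac12$, so these are well defined.) *Algorithm.* For $t\ge 0$ let $\mathcal K_t=\{x\in\mathbb R^M: x+\beta_t v\in\mathcal K\ \text{for all}\ v\in[-V,V]^M\}$, and assume $\theta^*\in\mathcal K_0$ and $\mathbf 0\in\mathcal K_0$. For $t\ge1$ let $\nu_{i,t}$ be random vectors in $[-V,V]^M$ such that, for each $i$ and $t$, the coordinates of $\nu_{i,t}$ are i.i.d., $\mathbb E[\nu_{i,t}]=\mathbf 0$ and $\mathbb E[\nu_{i,t}\nu_{i,t}^{\mathsf T}]=\mathbf I_M$. The vectors $\nu_{i,t}$ are independent over $i$ for each $t$; for each $t$ the families $(\nu_{i,t})_i$ and $(\xi_{i,t})_i$ are independent; and the pairs $\bigl((\nu_{i,t})_i,(\xi_{i,t})_i\bigr)$ are independent over $t$. Start from $\theta_i(1)=\mathbf 0$ and, for $t\ge1$, let $$\theta_i(t+1)\in\operatorname*{arg\,min}_{x\in\mathcal K_{t+1}}\Bigl\|\sum_{j=1}^NA_{i,j}(t)\theta_j(t)-\alpha_t\widehat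 g_i(t)-x\Bigr\|,\qquad \widehat g_i(t)=\frac{\nu_{i,t}F_i(\theta_i(t)+\beta_t\nu_{i,t};\xi_{i,t})}{\beta_t}.$$ *Conclusion.* With $\overline\theta^{(T)}=\frac1{NT}\sum_{t=1}^T\sum_{i=1}^N\theta_i(t)$, for every $T\ge1$ the random variable $f(\overline\theta^{(T)})-f(\theta^*)$ is integrable and $$\mathbb E\bigl[f(\overline\theta^{(T)})-f(\theta^*)\bigr]\le\frac LN\Psi^*\lambda_{\mathsf I}^2\Bigl(\frac1{\sqrt T}+\frac{\lambda_{\mathsf{II}}}{\mu\sqrt{6\lambda_{\mathsf{III}}}}\frac{\log T}{T}+\Bigl(\frac{\lambda_{\mathsf{II}}}{\mu\sqrt{6\lambda_{\mathsf{III}}}}+\frac{\lambda_{\mathsf{II}}^2}{4\mu^2\lambda_{\mathsf{III}}}\Bigr)\frac1T\Bigr),$$ and the right-hand side is $O(M^2T^{-1/2})$: it is at most $c\,M^2T^{-1/2}$ with a constant $c$ that depends only on $N,\tau,a,V,C,L,\mu,R$ (not on $M$, $T$ or the problem instance). -/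

import Mathlib

open MeasureTheory ProbabilityTheory

noncomputable section

namespace DZOSCO

/-- `ℝ^M` with the Euclidean norm. -/
abbrev Vec (M : ℕ) : Type := EuclideanSpace ℝ (Fin M)

/-! ### The network -/

/-- Assumption on the communication matrices. The edge set at time `t` is
`{(i, j) : A t i j ≠ 0}`; every node keeps a positive weight on its own value. -/
structure Network {N : ℕ} (A : ℕ → Matrix (Fin N) (Fin N) ℝ) (a : ℝ) (τ : ℕ) : Prop where
  doublyStochastic : ∀ t, A t ∈ doublyStochastic ℝ (Fin N)
  weight_le : ∀ t i j, A t i j ≠ 0 → a ≤ A t i j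
  self_weight : ∀ t i, A t i i ≠ 0
  /-- The union of the edge sets over any `τ` consecutive times is strongly connected. -/
  connected : ∀ t₀ i j,
    Relation.ReflTransGen (fun k l => ∃ t, t₀ ≤ t ∧ t < t₀ + τ ∧ A t k l ≠ 0) i j

/-! ### The cost functions -/

/-- Expected local cost `f_i(θ) = E[F_i(θ; ξ_i)]`, where `ξ_i` has law `D`. -/
def localCost {M : ℕ} {S : Type*} [MeasurableSpace S] (F : Vec M → S → ℝ) (D : Measure S)
    (θ : Vec M) : ℝ :=
  ∫ s, F θ s ∂D

/-- Expected global cost `f(θ) = (1/N) ∑ i, f_i(θ)`. -/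
def globalCost {N M : ℕ} {S : Fin N → Type*} [∀ i, MeasurableSpace (S i)]
    (F : ∀ i, Vec M → S i → ℝ) (D : ∀ i, Measure (S i)) (θ : Vec M) : ℝ :=
  (∑ i, localCost (F i) (D i) θ) / N

/-- The feasible set is convex, contains the origin and lies in the ball of radius `R`. -/
structure Feasible {M : ℕ} (K : Set (Vec M)) (R : ℝ) : Prop where
  convex : Convex ℝ K
  zero_mem : (0 : Vec M) ∈ K
  norm_le : ∀ θ ∈ K, ‖θ‖ ≤ R

/-- `f` is `L`-smooth on `K`: it is differentiable on `K` (relative to `K`) and its gradient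
is `L`-Lipschitz on `K`. -/
def SmoothOn {M : ℕ} (f : Vec M → ℝ) (K : Set (Vec M)) (L : ℝ) : Prop :=
  ∃ g : Vec M → Vec M, (∀ x ∈ K, HasGradientWithinAt f (g x) K x) ∧
    ∀ x ∈ K, ∀ y ∈ K, ‖g x - g y‖ ≤ L * ‖x - y‖

/-! ### The random inputs -/

/-- The perturbations: `ν i t` takes values in `[-V, V]^M`, the coordinates of each `ν i t` are
i.i.d., the vectors of different nodes are independent, `E[ν] = 0` and `E[ν νᵀ] = I`. -/
structure Perturbation {N M : ℕ} {Ω : Type*} [MeasurableSpace Ω] (P : Measure Ω) (V : ℝ)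
    (ν : Fin N → ℕ → Ω → Vec M) : Prop where
  measurable : ∀ i t, Measurable (ν i t)
  abs_le : ∀ i t, 1 ≤ t → ∀ ω m, |ν i t ω m| ≤ V
  indep : ∀ t, 1 ≤ t → iIndepFun (fun (p : Fin N × Fin M) ω => ν p.1 t ω p.2) P
  identDistrib : ∀ i t, 1 ≤ t → ∀ m m',
    IdentDistrib (fun ω => ν i t ω m) (fun ω => ν i t ω m') P P
  mean : ∀ i t, 1 ≤ t → ∀ m, ∫ ω, ν i t ω m ∂P = 0
  covariance : ∀ i t, 1 ≤ t → ∀ m m',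
    ∫ ω, ν i t ω m * ν i t ω m' ∂P = if m = m' then 1 else 0

/-- The cost samples: `ξ i t` has law `D i`, samples at different times are independent, and at
each time they are independent of the perturbations. (The samples of different nodes at the
same time may be dependent.) -/
structure Sampling {N M : ℕ} {Ω : Type*} [MeasurableSpace Ω] (P : Measure Ω)
    {S : Fin N → Type*} [∀ i, MeasurableSpace (S i)] (D : ∀ i, Measure (S i))
    (ν : Fin N → ℕ → Ω → Vec M) (ξ : ∀ i, ℕ → Ω → S i) : Prop where
  measurable : ∀ i t, Measurable (ξ i t)
  law : ∀ i t, 1 ≤ t → P.map (ξ i t) = D i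
  indep_time : iIndepFun (fun (t : ℕ) ω => ((fun i => ν i t ω), (fun i => ξ i t ω))) P
  indep_perturbation : ∀ t, 1 ≤ t →
    IndepFun (fun ω i => ν i t ω) (fun ω i => ξ i t ω) P

/-! ### The algorithm -/

/-- The points `x` all of whose perturbations `x + b v`, `v ∈ [-V, V]^M`, lie in `K`. -/
def shrink {M : ℕ} (K : Set (Vec M)) (V b : ℝ) : Set (Vec M) :=
  {x | ∀ v : Vec M, (∀ m, |v m| ≤ V) → x + b • v ∈ K}

/-- `x` is a projection of `y` on `s`, that is, `x ∈ argmin_{x' ∈ s} ‖y - x'‖`. -/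
def IsProj {M : ℕ} (s : Set (Vec M)) (y x : Vec M) : Prop :=
  x ∈ s ∧ ∀ x' ∈ s, ‖y - x‖ ≤ ‖y - x'‖

/-- The single-point gradient estimate `ν F(θ + b ν; ξ) / b`. -/
def gradEst {M : ℕ} {S : Type*} (F : Vec M → S → ℝ) (b : ℝ) (θ ν : Vec M) (s : S) : Vec M :=
  (F (θ + b • ν) s / b) • ν

/-- `θ i t` is the iterate of node `i` at time `t ≥ 1` of the distributed projected algorithm
with step sizes `α t`, `β t`. -/
structure IsRun {N M : ℕ} {Ω : Type*} {S : Fin N → Type*} (A : ℕ → Matrix (Fin N) (Fin N) ℝ)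
    (K : Set (Vec M)) (V : ℝ) (α β : ℕ → ℝ) (F : ∀ i, Vec M → S i → ℝ)
    (ν : Fin N → ℕ → Ω → Vec M) (ξ : ∀ i, ℕ → Ω → S i) (θ : Fin N → ℕ → Ω → Vec M) : Prop where
  init : ∀ i ω, θ i 1 ω = 0
  step : ∀ i t, 1 ≤ t → ∀ ω,
    IsProj (shrink K V (β (t + 1)))
      (∑ j, A t i j • θ j t ω - α t • gradEst (F i) (β t) (θ i t ω) (ν i t ω) (ξ i t ω))
      (θ i (t + 1) ω)

/-- The average of the iterates over all nodes and over the times `1, …, T`. -/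
def average {N M : ℕ} {Ω : Type*} (θ : Fin N → ℕ → Ω → Vec M) (T : ℕ) (ω : Ω) : Vec M :=
  ((N : ℝ) * T)⁻¹ • ∑ t ∈ Finset.Icc 1 T, ∑ i, θ i t ω

/-! ### The constants -/

def rho (N τ : ℕ) (a : ℝ) : ℝ :=
  2 * ((1 + a ^ ((N - 1) * τ)) / (1 - a ^ ((N - 1) * τ)))

def eta (N τ : ℕ) (a : ℝ) : ℝ :=
  (1 - a ^ ((N - 1) * τ)) ^ (1 / (((N : ℝ) - 1) * τ))

/-- The factor `2^{7/4} + N ρ (10 - 7η) / (4 (1 - η)²)`. -/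
def kappa (N τ : ℕ) (a : ℝ) : ℝ :=
  2 ^ (7 / 4 : ℝ) + N * rho N τ a * ((10 - 7 * eta N τ a) / (4 * (1 - eta N τ a) ^ 2))

def lamI (N M : ℕ) (V L : ℝ) : ℝ :=
  √(N * M ^ 3) * V ^ 2 * L

def lamII (N M τ : ℕ) (a V C L : ℝ) : ℝ :=
  2 * L * √(N * M) * V * C * kappa N τ a

def lamIII (N M τ : ℕ) (a V C : ℝ) : ℝ :=
  2 * N * M * V ^ 2 * C ^ 2 * (kappa N τ a ^ 2 + 1)

def PsiStar (N M τ : ℕ) (a V C L μ R : ℝ) : ℝ :=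
  max
    (4 * √6 * N * R ^ 2 *
      ((lamI N M V L + lamI N M V L * lamII N M τ a V C L / (6 * μ * √(lamIII N M τ a V C))) ^ 2)⁻¹)
    (√(6 * lamIII N M τ a V C) / (lamI N M V L * μ ^ 2))

/-- The step size `α_t = (3/μ) t^{-1}`. -/
def alpha (μ : ℝ) (t : ℕ) : ℝ :=
  3 / μ * (t : ℝ)⁻¹

/-- The coefficient `β_0 = (6 λ_I^{-2} λ_III)^{1/4}`. -/
def beta0 (N M τ : ℕ) (a V C L : ℝ) : ℝ :=
  (6 * (lamI N M V L ^ 2)⁻¹ * lamIII N M τ a V C) ^ (1 / 4 : ℝ)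

/-- The step size `β_t = β_0 t^{-1/4}`. -/
def beta (N M τ : ℕ) (a V C L : ℝ) (t : ℕ) : ℝ :=
  beta0 N M τ a V C L * (t : ℝ) ^ (-(1 / 4) : ℝ)

/-- The explicit upper bound for the expected optimization error after `T` iterations. -/
def errorBound (N M τ : ℕ) (a V C L μ R : ℝ) (T : ℕ) : ℝ :=
  L / N * PsiStar N M τ a V C L μ R * lamI N M V L ^ 2 *
    (1 / √T
      + lamII N M τ a V C L / (μ * √(6 * lamIII N M τ a V C)) * (Real.log T / T)
      + (lamII N M τ a V C L / (μ * √(6 * lamIII N M τ a V C))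
          + lamII N M τ a V C L ^ 2 / (4 * μ ^ 2 * lamIII N M τ a V C)) * (1 / T))

end DZOSCO

end

/-! Let z be the minimizer and d_t = E ∑_i ‖θ_i(t) − z‖² (`meanSqDist`). Membership of z in the
shrunken set makes z interior to K, so the gradient of f vanishes there. Smoothness then gives f(x)
− f(z) ≤ (L/2)‖x − z‖², and Cauchy–Schwarz over nodes and times reduces the claim to bounding the
average of the d_t.

Three facts yield a recursion for d_t (`IsRun.meanSqDist_succ_le`). Consensus: products of the
matrices approach the uniform matrix geometrically (`Network.abs_transition_sub_le_rho`), and each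
step disturbs the averaging by at most δ_t = √M V C α_t/β_t, so every node is within κδ_t/2 of the
mean (`IsRun.norm_sub_mean_le`). Bias: the iterates depend on past inputs only. Taylor expansion of
the local cost around θ_i(t), with E ν = 0 and E ννᵀ = I, shows that the one-point estimate
correlates with any past-determined direction as the gradient does, up to O(β_t)
(`integral_inner_gradEst_ge`). Descent: doubly stochastic mixing and projection do not increase ∑_i
‖θ_i − z‖², and against the common direction mean − z the local gradients add up to a strongly
monotone one (`sum_norm_sq_step_le`, `sum_inner_gradient_ge`).

For t ≥ 6 the result is d_{t+1} ≤ (1 − 6/t) d_t + (α_t β_t λ_I + λ_II α_t²/(2β_t)) √d_t +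
(λ_III/2)(α_t/β_t)². Induction keeps d_t below w²(t^{-1/4} + x t^{-3/4})², with w² = Ψ*λ_I² and x =
λ_II/(μ√(6λ_III)). The two arguments of the maximum in Ψ* serve the two halves of this induction:
the first lets the diameter of K cover t ≤ 6, the second makes the inductive step close
(`envelope_step_of_recursion`). Summing the envelope gives the explicit bound. Its M-dependence is
read off from λ_I ∝ M^{3/2}, λ_II ∝ M^{1/2}, λ_III ∝ M, which leave x independent of M and make w²
at most of order M². -/

noncomputable section

namespace DZOSCO

/-! ### Products of the communication matrices -/

/-- The product `A (s + n - 1) * ⋯ * A s` of `n` consecutive communication matrices. -/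
def transition {N : ℕ} (A : ℕ → Matrix (Fin N) (Fin N) ℝ) (s : ℕ) : ℕ → Matrix (Fin N) (Fin N) ℝ
  | 0 => 1
  | n + 1 => A (s + n) * transition A s n

section Transition

variable {N : ℕ} {A : ℕ → Matrix (Fin N) (Fin N) ℝ} {a : ℝ} {τ : ℕ}

lemma transition_add (s n m : ℕ) :
    transition A s (n + m) = transition A (s + n) m * transition A s n := by
  induction m with
  | zero => simp [transition]
  | succ m ih =>
    rw [← add_assoc, transition, ih, transition, Matrix.mul_assoc, add_assoc]

lemma Network.transition_mem (h : Network A a τ) (s n : ℕ) :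
    transition A s n ∈ _root_.doublyStochastic ℝ (Fin N) := by
  induction n with
  | zero => exact one_mem _
  | succ n ih => exact mul_mem (h.doublyStochastic _) ih

lemma Network.transition_nonneg (h : Network A a τ) (s n : ℕ) (i j : Fin N) :
    0 ≤ transition A s n i j :=
  nonneg_of_mem_doublyStochastic (h.transition_mem s n)

lemma Network.nonneg (h : Network A a τ) (t : ℕ) (i j : Fin N) : 0 ≤ A t i j :=
  nonneg_of_mem_doublyStochastic (h.doublyStochastic t)

lemma Network.mul_le_transition_succ (h : Network A a τ) (s n : ℕ) (i j k : Fin N) :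
    A (s + n) i k * transition A s n k j ≤ transition A s (n + 1) i j := by
  rw [transition, Matrix.mul_apply]
  exact Finset.single_le_sum (f := fun k => A (s + n) i k * transition A s n k j)
    (fun k _ => mul_nonneg (h.nonneg _ _ _) (h.transition_nonneg _ _ _ _)) (Finset.mem_univ k)

lemma Network.transition_succ_ne_zero (h : Network A a τ) {s n : ℕ} {i j k : Fin N}
    (hA : A (s + n) i k ≠ 0) (hT : transition A s n k j ≠ 0) :
    transition A s (n + 1) i j ≠ 0 :=
  ((mul_pos ((h.nonneg _ _ _).lt_of_ne' hA) ((h.transition_nonneg _ _ _ _).lt_of_ne' hT)).trans_le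
    (h.mul_le_transition_succ s n i j k)).ne'

/-- Nonzero entries of a product of `n` communication matrices are at least `a ^ n`. -/
lemma Network.pow_le_transition (h : Network A a τ) (ha : 0 ≤ a) (s n : ℕ) (i j : Fin N)
    (hT : transition A s n i j ≠ 0) : a ^ n ≤ transition A s n i j := by
  induction n generalizing i with
  | zero =>
    by_cases hij : i = j
    · subst hij; simp [transition]
    · exact absurd (by simp [transition, hij]) hT
  | succ n ih =>
    have : ∃ k, A (s + n) i k * transition A s n k j ≠ 0 := by
      by_contra! hc
      exact hT (by rw [transition, Matrix.mul_apply]; exact Finset.sum_eq_zero fun k _ => hc k)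
    obtain ⟨k, hk⟩ := this
    refine le_trans ?_ (h.mul_le_transition_succ s n i j k)
    rw [pow_succ']
    exact mul_le_mul (h.weight_le _ _ _ (left_ne_zero_of_mul hk)) (ih k (right_ne_zero_of_mul hk))
      (by positivity) (h.nonneg _ _ _)

open Classical in
/-- The nodes that the value of node `j` at time `s` has reached after `n` steps. -/
def reached {N : ℕ} (A : ℕ → Matrix (Fin N) (Fin N) ℝ) (s n : ℕ) (j : Fin N) : Finset (Fin N) :=
  Finset.univ.filter fun i => transition A s n i j ≠ 0

lemma mem_reached {s n : ℕ} {i j : Fin N} : i ∈ reached A s n j ↔ transition A s n i j ≠ 0 := by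
  simp [reached]

/-- Positive self-weights keep a reached node reached. -/
lemma Network.reached_mono (h : Network A a τ) (s : ℕ) (j : Fin N) :
    Monotone fun n => reached A s n j :=
  monotone_nat_of_le_succ fun n i hi => by
    rw [mem_reached] at hi ⊢
    exact h.transition_succ_ne_zero (h.self_weight _ _) hi

lemma self_mem_reached_zero (s : ℕ) (j : Fin N) : j ∈ reached A s 0 j := by
  simp [mem_reached, transition]

/-- A path that starts outside p and ends inside must cross the boundary along one of its edges. -/
lemma exists_exit_of_reflTransGen {α : Type*} {r : α → α → Prop} {p : α → Prop} {x y : α}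
    (h : Relation.ReflTransGen r x y) (hx : ¬ p x) (hy : p y) : ∃ k l, r k l ∧ ¬ p k ∧ p l := by
  induction h with
  | refl => exact absurd hy hx
  | @tail b c _ hbc ih =>
    by_cases hb : p b
    · exact ih hb
    · exact ⟨b, c, hbc, hb, hy⟩

/-- If nothing were gained in a window of τ steps, connectivity of that window would still supply an
edge (k, l) with l reached and k not, and using this edge makes k reached within the window. -/
lemma Network.card_reached_lt (h : Network A a τ) (s n : ℕ) (j : Fin N)
    (hne : reached A s n j ≠ Finset.univ) :
    (reached A s n j).card < (reached A s (n + τ) j).card := by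
  apply Finset.card_lt_card
  refine (h.reached_mono s j (Nat.le_add_right n τ)).lt_of_ne fun heq => ?_
  obtain ⟨i, hi⟩ : ∃ i, i ∉ reached A s n j := by
    by_contra! hc
    exact hne (Finset.eq_univ_iff_forall.2 hc)
  obtain ⟨k, l, ⟨t, ht1, ht2, hA⟩, hk, hl⟩ := exists_exit_of_reflTransGen
    (p := fun i => i ∈ reached A s n j) (h.connected (s + n) i j) hi
    (h.reached_mono s j (Nat.zero_le n) (self_mem_reached_zero s j))
  obtain ⟨m, rfl⟩ : ∃ m, t = s + m := ⟨t - s, by omega⟩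
  apply hk
  -- The edge is active at some time s + m of the window; monotonicity says that l is already
  -- reached by then.
  have hl' : l ∈ reached A s m j := h.reached_mono s j (by omega : n ≤ m) hl
  have hk' : k ∈ reached A s (m + 1) j :=
    mem_reached.2 (h.transition_succ_ne_zero hA (mem_reached.1 hl'))
  have := h.reached_mono s j (by omega : m + 1 ≤ n + τ) hk'
  rwa [← heq] at this

lemma Network.le_card_reached (h : Network A a τ) (s q : ℕ) (j : Fin N) (hq : q + 1 ≤ N) :
    q + 1 ≤ (reached A s (q * τ) j).card := by
  induction q with
  | zero =>
    rw [zero_mul]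
    exact Finset.card_pos.2 ⟨j, self_mem_reached_zero s j⟩
  | succ q ih =>
    have ih := ih (by omega)
    rw [Nat.succ_mul]
    by_cases hne : reached A s (q * τ) j = Finset.univ
    · have : reached A s (q * τ + τ) j = Finset.univ :=
        Finset.eq_univ_iff_forall.2 fun i =>
          h.reached_mono s j (Nat.le_add_right _ τ) (by simp [hne])
      rw [this]; simpa using hq
    · exact (Nat.succ_le_succ ih).trans (h.card_reached_lt s _ j hne)

/-- After `(N - 1) τ` steps every node has reached every other node. -/
lemma Network.pow_le_transition_window (h : Network A a τ) (ha : 0 ≤ a) (s : ℕ) (i j : Fin N) :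
    a ^ ((N - 1) * τ) ≤ transition A s ((N - 1) * τ) i j := by
  apply h.pow_le_transition ha
  have hN : 0 < N := i.pos
  have hcard := h.le_card_reached s (N - 1) j (by omega)
  have : reached A s ((N - 1) * τ) j = Finset.univ := by
    apply Finset.eq_univ_of_card
    apply le_antisymm (Finset.card_le_univ _)
    simp only [Fintype.card_fin]; omega
  exact mem_reached.1 (this ▸ Finset.mem_univ i)

/-- Connectivity forces an edge between distinct nodes k and l; row k then contains two entries of
size at least a, and it sums to 1. -/
lemma Network.weight_le_half (h : Network A a τ) (hN : 2 ≤ N) : a ≤ 1 / 2 := by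
  let i : Fin N := ⟨0, by omega⟩
  let j : Fin N := ⟨1, by omega⟩
  obtain ⟨k, l, ⟨t, -, -, hA⟩, hk, hl⟩ := exists_exit_of_reflTransGen (p := fun x => x = j)
    (h.connected 0 i j) (by simp [i, j]) rfl
  have hkl : k ≠ l := fun e => hk (e.trans hl)
  have h1 := h.weight_le t k k (h.self_weight t k)
  have h2 := h.weight_le t k l hA
  have h3 : A t k k + A t k l ≤ ∑ x, A t k x := by
    rw [← Finset.sum_pair hkl]
    exact Finset.sum_le_sum_of_subset_of_nonneg (Finset.subset_univ _)
      fun x _ _ => h.nonneg t k x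
  rw [sum_row_of_mem_doublyStochastic (h.doublyStochastic t)] at h3
  linarith

/-- A doubly stochastic matrix with entries at least `δ` contracts the distance to the uniform
matrix by the factor `1 - δ`. -/
lemma abs_mul_sub_le {P Q : Matrix (Fin N) (Fin N) ℝ} {δ c : ℝ}
    (hP : P ∈ doublyStochastic ℝ (Fin N)) (hQ : Q ∈ doublyStochastic ℝ (Fin N)) (hδ : 0 ≤ δ)
    (hPδ : ∀ i j, δ ≤ P i j) (hQc : ∀ i j, |Q i j - 1 / N| ≤ c) (i j : Fin N) :
    |(P * Q) i j - 1 / N| ≤ (1 - δ) * c := by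
  have hN : (1 : ℝ) ≤ N := by exact_mod_cast i.pos
  have hc : 0 ≤ c := (abs_nonneg _).trans (hQc i j)
  have hrow : ∑ k, P i k = 1 := sum_row_of_mem_doublyStochastic hP i
  have hcol : ∑ k, Q k j = 1 := sum_col_of_mem_doublyStochastic hQ j
  -- Columns of Q − 1/N sum to zero, so every entry of P may be lowered by δ without changing the
  -- product.
  have key : (P * Q) i j - 1 / N = ∑ k, (P i k - δ) * (Q k j - 1 / N) := by
    have e : ∀ k, (P i k - δ) * (Q k j - 1 / N)
        = P i k * Q k j - P i k * (1 / N) - δ * (Q k j) + δ * (1 / N) := fun k => by ring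
    simp only [e, Finset.sum_add_distrib, Finset.sum_sub_distrib, ← Finset.sum_mul,
      ← Finset.mul_sum, hrow, hcol, Matrix.mul_apply, Finset.sum_const, Finset.card_univ,
      Fintype.card_fin, nsmul_eq_mul]
    field_simp
    ring
  rw [key]
  calc |∑ k, (P i k - δ) * (Q k j - 1 / N)|
      ≤ ∑ k, (P i k - δ) * c := by
        refine (Finset.abs_sum_le_sum_abs _ _).trans (Finset.sum_le_sum fun k _ => ?_)
        rw [abs_mul, abs_of_nonneg (sub_nonneg.2 (hPδ i k))]
        exact mul_le_mul_of_nonneg_left (hQc k j) (sub_nonneg.2 (hPδ i k))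
    _ = (1 - N * δ) * c := by
        rw [← Finset.sum_mul, Finset.sum_sub_distrib, hrow]; simp
    -- The true contraction factor is 1 − Nδ; the weaker 1 − δ is the one that defines η.
    _ ≤ (1 - δ) * c := by
        apply mul_le_mul_of_nonneg_right _ hc
        nlinarith

/-- The r leftover steps come first and cost nothing, since entries in [0, 1] are within 1 of 1/N.
Each later window of (N − 1)τ steps contracts. -/
lemma Network.abs_transition_sub_le (h : Network A a τ) (ha : 0 ≤ a) (s q r : ℕ) (i j : Fin N) :
    |transition A s (r + q * ((N - 1) * τ)) i j - 1 / N| ≤ (1 - a ^ ((N - 1) * τ)) ^ q := by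
  induction q generalizing i j with
  | zero =>
    have h0 := h.transition_nonneg s r i j
    have h1 : transition A s r i j ≤ 1 := le_one_of_mem_doublyStochastic (h.transition_mem s r)
    have hN : (1 : ℝ) ≤ N := by exact_mod_cast i.pos
    have h2 : 1 / (N : ℝ) ≤ 1 := by rw [div_le_one (by linarith)]; exact hN
    have h3 : 0 ≤ 1 / (N : ℝ) := by positivity
    rw [zero_mul, add_zero, pow_zero, abs_le]
    constructor <;> linarith
  | succ q ih =>
    rw [Nat.succ_mul, ← add_assoc, transition_add, pow_succ']
    exact abs_mul_sub_le (h.transition_mem _ _) (h.transition_mem _ _) (by positivity)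
      (h.pow_le_transition_window ha _) ih i j

end Transition

/-! ### The constants of the network -/

section Constants

variable {N τ : ℕ} {a : ℝ}

lemma pow_window_pos (ha : 0 < a) : 0 < a ^ ((N - 1) * τ) := by positivity

lemma window_pos (hN : 2 ≤ N) (hτ : 1 ≤ τ) : 0 < (N - 1) * τ :=
  Nat.mul_pos (by omega) hτ

lemma pow_window_le_half (hN : 2 ≤ N) (hτ : 1 ≤ τ) (ha : 0 < a) (ha' : a ≤ 1 / 2) :
    a ^ ((N - 1) * τ) ≤ 1 / 2 :=
  (pow_le_of_le_one ha.le (by linarith) (window_pos hN hτ).ne').trans ha'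

lemma cast_window (hN : 2 ≤ N) : (((N - 1) * τ : ℕ) : ℝ) = ((N : ℝ) - 1) * τ := by
  push_cast [Nat.cast_sub (by omega : 1 ≤ N)]; ring

lemma eta_pow_window (hN : 2 ≤ N) (hτ : 1 ≤ τ) (ha : 0 < a) (ha' : a ≤ 1 / 2) :
    eta N τ a ^ ((N - 1) * τ) = 1 - a ^ ((N - 1) * τ) := by
  have h1 := pow_window_le_half hN hτ ha ha'
  rw [eta, ← cast_window hN, one_div]
  exact Real.rpow_inv_natCast_pow (by linarith) (window_pos hN hτ).ne'

lemma eta_pos (hN : 2 ≤ N) (hτ : 1 ≤ τ) (ha : 0 < a) (ha' : a ≤ 1 / 2) : 0 < eta N τ a := by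
  have h1 := pow_window_le_half hN hτ ha ha'
  exact Real.rpow_pos_of_pos (by linarith) _

lemma eta_lt_one (hN : 2 ≤ N) (hτ : 1 ≤ τ) (ha : 0 < a) (ha' : a ≤ 1 / 2) : eta N τ a < 1 := by
  have h1 := pow_window_le_half hN hτ ha ha'
  have h2 := eta_pow_window hN hτ ha ha'
  have h3 : 0 < a ^ ((N - 1) * τ) := pow_window_pos ha
  by_contra! hc
  have := one_le_pow₀ hc (n := (N - 1) * τ)
  linarith

lemma inv_le_rho (hN : 2 ≤ N) (hτ : 1 ≤ τ) (ha : 0 < a) (ha' : a ≤ 1 / 2) :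
    (1 - a ^ ((N - 1) * τ))⁻¹ ≤ rho N τ a / 2 := by
  have h1 := pow_window_le_half hN hτ ha ha'
  have h3 : 0 < a ^ ((N - 1) * τ) := pow_window_pos ha
  rw [rho, mul_div_cancel_left₀ _ two_ne_zero, inv_eq_one_div]
  exact div_le_div_of_nonneg_right (by linarith) (by linarith)

lemma one_le_rho_half (hN : 2 ≤ N) (hτ : 1 ≤ τ) (ha : 0 < a) (ha' : a ≤ 1 / 2) :
    1 ≤ rho N τ a / 2 := by
  have h1 := pow_window_le_half hN hτ ha ha'
  have h3 : 0 < a ^ ((N - 1) * τ) := pow_window_pos ha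
  exact ((one_le_inv₀ (by linarith)).2 (by linarith)).trans (inv_le_rho hN hτ ha ha')

lemma Network.abs_transition_sub_le_rho {A : ℕ → Matrix (Fin N) (Fin N) ℝ} (h : Network A a τ)
    (hN : 2 ≤ N) (hτ : 1 ≤ τ) (ha : 0 < a) (s n : ℕ) (i j : Fin N) :
    |transition A s n i j - 1 / N| ≤ rho N τ a / 2 * eta N τ a ^ n := by
  have ha' := h.weight_le_half hN
  set B := (N - 1) * τ with hB
  have hB0 : 0 < B := window_pos hN hτ
  have h1 : a ^ B ≤ 1 / 2 := pow_window_le_half hN hτ ha ha'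
  have h2 : eta N τ a ^ B = 1 - a ^ B := eta_pow_window hN hτ ha ha'
  have h3 := eta_pos hN hτ ha ha'
  have h4 := eta_lt_one hN hτ ha ha'
  have hn : n = n % B + n / B * B := (Nat.mod_add_div' n B).symm
  have h5 := h.abs_transition_sub_le ha.le s (n / B) (n % B) i j
  rw [← hB, ← hn] at h5
  refine h5.trans ?_
  -- Rounding n up to the next multiple of B costs one factor (1 − a^B)⁻¹, which ρ/2 absorbs.
  have h6 : (1 - a ^ B) ^ (n / B) = (1 - a ^ B)⁻¹ * eta N τ a ^ (B * (n / B + 1)) := by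
    rw [pow_mul (eta N τ a), h2, pow_succ, mul_comm, mul_assoc, mul_inv_cancel₀ (by linarith), mul_one]
  rw [h6]
  have h7 : eta N τ a ^ (B * (n / B + 1)) ≤ eta N τ a ^ n := by
    apply pow_le_pow_of_le_one h3.le h4.le
    exact (Nat.lt_mul_div_succ n hB0).le
  exact mul_le_mul (inv_le_rho hN hτ ha ha') h7 (by positivity)
    (by linarith [one_le_rho_half hN hτ ha ha'])

end Constants

/-! ### Consensus -/

section Consensus

variable {N τ : ℕ} {a : ℝ} {A : ℕ → Matrix (Fin N) (Fin N) ℝ}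
  {E : Type*} [NormedAddCommGroup E] [NormedSpace ℝ E]

/-- The iterates of a perturbed averaging process, in terms of the perturbations. -/
lemma iterate_eq_sum {x e : ℕ → Fin N → E} (h1 : ∀ i, x 1 i = 0)
    (hstep : ∀ t, 1 ≤ t → ∀ i, x (t + 1) i = ∑ j, A t i j • x t j + e t i) (n : ℕ) (i : Fin N) :
    x (n + 1) i
      = ∑ s ∈ Finset.range n, ∑ j, transition A (s + 2) (n - 1 - s) i j • e (s + 1) j := by
  induction n generalizing i with
  | zero => simpa using h1 i
  | succ n ih =>
    -- The newest error enters unmixed, with the empty product; every older one acquires the factor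
    -- A(n + 1).
    rw [hstep (n + 1) (by omega), Finset.sum_range_succ]
    congr 1
    · simp only [ih, Finset.smul_sum, smul_smul]
      rw [Finset.sum_comm]
      refine Finset.sum_congr rfl fun s hs => ?_
      have hs : s < n := Finset.mem_range.1 hs
      rw [Finset.sum_comm]
      refine Finset.sum_congr rfl fun j _ => ?_
      rw [← Finset.sum_smul]
      have e1 : n + 1 - 1 - s = (n - 1 - s) + 1 := by omega
      have e2 : s + 2 + (n - 1 - s) = n + 1 := by omega
      rw [e1, transition, e2, Matrix.mul_apply]
    · have e1 : n + 1 - 1 - n = 0 := by omega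
      rw [e1]
      simp [transition, Matrix.one_apply, ite_smul]

/-- The distance of each node to the average of a perturbed averaging process. -/
lemma Network.norm_iterate_sub_average_le (h : Network A a τ) (hN : 2 ≤ N) (hτ : 1 ≤ τ)
    (ha : 0 < a) {x e : ℕ → Fin N → E} {ε : ℕ → ℝ} (h1 : ∀ i, x 1 i = 0)
    (hstep : ∀ t, 1 ≤ t → ∀ i, x (t + 1) i = ∑ j, A t i j • x t j + e t i)
    (he : ∀ t, 1 ≤ t → ∀ i, ‖e t i‖ ≤ ε t) (n : ℕ) (i : Fin N) :
    ‖x (n + 1) i - (1 / N : ℝ) • ∑ j, x (n + 1) j‖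
      ≤ N * (rho N τ a / 2) * ∑ s ∈ Finset.range n, eta N τ a ^ (n - 1 - s) * ε (s + 1) := by
  -- Column sums are 1, so averaging removes the transition matrices, and the difference to node i
  -- involves only their distance to 1/N.
  have havg : (1 / N : ℝ) • ∑ j, x (n + 1) j
      = ∑ s ∈ Finset.range n, ∑ j, (1 / N : ℝ) • e (s + 1) j := by
    simp only [iterate_eq_sum h1 hstep n]
    rw [Finset.sum_comm, Finset.smul_sum]
    refine Finset.sum_congr rfl fun s _ => ?_
    rw [Finset.sum_comm, Finset.smul_sum]
    refine Finset.sum_congr rfl fun j _ => ?_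
    rw [← Finset.sum_smul, sum_col_of_mem_doublyStochastic (h.transition_mem _ _), one_smul]
  rw [havg, iterate_eq_sum h1 hstep n, ← Finset.sum_sub_distrib, Finset.mul_sum]
  refine (norm_sum_le _ _).trans (Finset.sum_le_sum fun s _ => ?_)
  rw [← Finset.sum_sub_distrib]
  calc ‖∑ j, (transition A (s + 2) (n - 1 - s) i j • e (s + 1) j - (1 / N : ℝ) • e (s + 1) j)‖
      ≤ ∑ _j : Fin N, rho N τ a / 2 * eta N τ a ^ (n - 1 - s) * ε (s + 1) := by
        refine (norm_sum_le _ _).trans (Finset.sum_le_sum fun j _ => ?_)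
        rw [← sub_smul, norm_smul, Real.norm_eq_abs]
        have h2 := h.abs_transition_sub_le_rho hN hτ ha (s + 2) (n - 1 - s) i j
        exact mul_le_mul h2 (he _ (by omega) j) (norm_nonneg _) ((abs_nonneg _).trans h2)
    _ = _ := by simp; ring

end Consensus

/-! ### Convolution of a geometric sequence with t^{-3/4} -/

/-- Bernoulli's inequality for the exponent 3/4: (1 + k/s)^{3/4} ≤ 1 + 3k/(4s), and s ≥ 1. -/
lemma rpow_neg_le_mul_rpow_neg {s k : ℕ} (hs : 1 ≤ s) :
    (s : ℝ) ^ (-(3 / 4) : ℝ) ≤ (1 + 3 / 4 * k) * ((s + k : ℕ) : ℝ) ^ (-(3 / 4) : ℝ) := by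
  have hs' : (1 : ℝ) ≤ s := by exact_mod_cast hs
  have hs0 : (0 : ℝ) < s := by linarith
  have hk : (0 : ℝ) ≤ k := Nat.cast_nonneg k
  have h1 : ((s : ℝ) + k) / s = 1 + k / s := by field_simp
  have h2 : (((s : ℝ) + k) / s) ^ (3 / 4 : ℝ) ≤ 1 + 3 / 4 * k := by
    rw [h1]
    refine (rpow_one_add_le_one_add_mul_self ?_ (by norm_num) (by norm_num)).trans ?_
    · linarith [div_nonneg hk hs0.le]
    · have := div_le_self hk hs'
      linarith
  rw [Real.div_rpow (by positivity) hs0.le] at h2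
  push_cast
  rw [Real.rpow_neg hs0.le, Real.rpow_neg (by positivity)]
  have h3 : 0 < (s : ℝ) ^ (3 / 4 : ℝ) := by positivity
  have h4 : 0 < ((s : ℝ) + k) ^ (3 / 4 : ℝ) := by positivity
  rw [div_le_iff₀ h3] at h2
  rw [← div_eq_mul_inv, le_div_iff₀ h4, inv_mul_le_iff₀ h3]
  linarith

/-- The right side is the value of the infinite series; the partial sum has a closed form in which
the nonnegative tail is explicit. -/
lemma sum_geometric_mul_linear_le {r : ℝ} (h0 : 0 ≤ r) (h1 : r < 1) (n : ℕ) :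
    ∑ k ∈ Finset.range n, r ^ k * (1 + 3 / 4 * (k + 1 : ℝ)) ≤ (7 - 4 * r) / (4 * (1 - r) ^ 2) := by
  have h2 : 0 < 1 - r := by linarith
  have key : ∑ k ∈ Finset.range n, r ^ k * (1 + 3 / 4 * (k + 1 : ℝ))
      = (7 - 4 * r) / (4 * (1 - r) ^ 2) - r ^ n * ((7 - 4 * r) / (4 * (1 - r) ^ 2)
        + 3 / 4 * n / (1 - r)) := by
    induction n with
    | zero => simp
    | succ n ih =>
      rw [Finset.sum_range_succ, ih]
      push_cast
      field_simp
      ring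
  rw [key]
  have : 0 ≤ r ^ n * ((7 - 4 * r) / (4 * (1 - r) ^ 2) + 3 / 4 * n / (1 - r)) := by
    have : 0 ≤ 7 - 4 * r := by linarith
    positivity
  linarith

/-- An error k + 1 steps old exceeds the current scale only by the linear factor 1 + 3(k + 1)/4,
which the geometric weights make summable. Hence the disagreement decays like α_t/β_t itself. -/
lemma sum_geometric_mul_rpow_le {r : ℝ} (h0 : 0 ≤ r) (h1 : r < 1) (n : ℕ) :
    ∑ s ∈ Finset.range n, r ^ (n - 1 - s) * ((s + 1 : ℕ) : ℝ) ^ (-(3 / 4) : ℝ)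
      ≤ (7 - 4 * r) / (4 * (1 - r) ^ 2) * ((n + 1 : ℕ) : ℝ) ^ (-(3 / 4) : ℝ) := by
  rw [← Finset.sum_range_reflect]
  refine le_trans (Finset.sum_le_sum fun k hk => ?_)
    (le_of_eq_of_le (Finset.sum_mul _ _ _).symm
      (mul_le_mul_of_nonneg_right (sum_geometric_mul_linear_le h0 h1 n) (by positivity)))
  have hk : k < n := Finset.mem_range.1 hk
  have e1 : n - 1 - (n - 1 - k) = k := by omega
  rw [e1, mul_assoc]
  apply mul_le_mul_of_nonneg_left _ (pow_nonneg h0 _)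
  have h3 := rpow_neg_le_mul_rpow_neg (s := n - 1 - k + 1) (k := k + 1) (by omega)
  have e2 : n - 1 - k + 1 + (k + 1) = n + 1 := by omega
  rw [e2] at h3
  simpa using h3

/-! ### Smooth and strongly convex functions on a convex set -/

section Convex

open scoped RealInnerProductSpace Topology
open Set

variable {M : ℕ} {K : Set (Vec M)} {f : Vec M → ℝ} {g : Vec M → Vec M} {L μ : ℝ}

lemma add_smul_sub_mem (hK : Convex ℝ K) {x y : Vec M} (hx : x ∈ K) (hy : y ∈ K) {s : ℝ}
    (hs : s ∈ Icc (0 : ℝ) 1) : x + s • (y - x) ∈ K :=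
  hK.add_smul_sub_mem hx hy hs

lemma hasDerivWithinAt_segment (hK : Convex ℝ K) (hg : ∀ x ∈ K, HasGradientWithinAt f (g x) K x)
    {x y : Vec M} (hx : x ∈ K) (hy : y ∈ K) {s : ℝ} (hs : s ∈ Icc (0 : ℝ) 1) :
    HasDerivWithinAt (fun s : ℝ => f (x + s • (y - x))) ⟪g (x + s • (y - x)), y - x⟫
      (Icc 0 1) s := by
  have h1 : HasDerivWithinAt (fun s : ℝ => x + s • (y - x)) (y - x) (Icc 0 1) s := by
    have := ((hasDerivAt_id s).smul_const (y - x)).const_add x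
    simpa using this.hasDerivWithinAt
  have h2 := (hg _ (add_smul_sub_mem hK hx hy hs)).hasFDerivWithinAt
  have h3 := h2.comp_hasDerivWithinAt s h1 fun r hr => add_smul_sub_mem hK hx hy hr
  exact h3.congr_deriv (by simp)

/-- The first-order Taylor estimate for a function with Lipschitz gradient. -/
lemma abs_sub_sub_inner_le (hK : Convex ℝ K) (hg : ∀ x ∈ K, HasGradientWithinAt f (g x) K x)
    (hL : ∀ x ∈ K, ∀ y ∈ K, ‖g x - g y‖ ≤ L * ‖x - y‖) {x y : Vec M} (hx : x ∈ K) (hy : y ∈ K) :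
    |f y - f x - ⟪g x, y - x⟫| ≤ L / 2 * ‖y - x‖ ^ 2 := by
  have hd : ∀ s ∈ Icc (0 : ℝ) 1, HasDerivWithinAt
      (fun s : ℝ => f (x + s • (y - x)) - f x - s * ⟪g x, y - x⟫)
      (⟪g (x + s • (y - x)), y - x⟫ - ⟪g x, y - x⟫) (Icc 0 1) s := fun s hs => by
    have h1 := hasDerivWithinAt_segment hK hg hx hy hs
    have h2 : HasDerivWithinAt (fun s : ℝ => s * ⟪g x, y - x⟫) (1 * ⟪g x, y - x⟫) (Icc 0 1) s :=
      (hasDerivWithinAt_id s _).mul_const _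
    exact ((h1.sub_const (f x)).sub h2).congr_deriv (by rw [one_mul])
  -- Mean value inequality on [0, 1] against the comparison function (L/2)‖y − x‖²s². Right
  -- derivatives suffice, so differentiability relative to K is enough.
  have key := image_norm_le_of_norm_deriv_right_le_deriv_boundary
    (f := fun s : ℝ => f (x + s • (y - x)) - f x - s * ⟪g x, y - x⟫)
    (f' := fun s => ⟪g (x + s • (y - x)), y - x⟫ - ⟪g x, y - x⟫)
    (B := fun s => L / 2 * ‖y - x‖ ^ 2 * s ^ 2) (B' := fun s => L * ‖y - x‖ ^ 2 * s)
    (a := 0) (b := 1) (fun s hs => (hd s hs).continuousWithinAt)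
    (fun s hs => (hd s ⟨hs.1, hs.2.le⟩).mono_of_mem_nhdsWithin
      (mem_nhdsWithin.2 ⟨Iio 1, isOpen_Iio, hs.2, fun r hr => ⟨hs.1.trans hr.2, (mem_Iio.1 hr.1).le⟩⟩)) (by simp)
    (fun s => by
      have := ((hasDerivAt_id s).pow 2).const_mul (L / 2 * ‖y - x‖ ^ 2)
      exact this.congr_deriv (by simp; ring))
    (fun s hs => by
      rw [← inner_sub_left, Real.norm_eq_abs]
      refine (abs_real_inner_le_norm _ _).trans ?_
      have h1 := hL _ (add_smul_sub_mem hK hx hy ⟨hs.1, hs.2.le⟩) _ hx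
      rw [add_sub_cancel_left, norm_smul, Real.norm_eq_abs, abs_of_nonneg hs.1] at h1
      nlinarith [mul_le_mul_of_nonneg_right h1 (norm_nonneg (y - x))])
    (right_mem_Icc.2 zero_le_one)
  simpa using key

/-- Divide the strong convexity inequality on the segment by its parameter s and let s → 0⁺. -/
lemma StrongConvexOn.add_inner_le (hf : StrongConvexOn K μ f)
    (hg : ∀ x ∈ K, HasGradientWithinAt f (g x) K x) {x y : Vec M} (hx : x ∈ K) (hy : y ∈ K) :
    f x + ⟪g x, y - x⟫ + μ / 2 * ‖y - x‖ ^ 2 ≤ f y := by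
  have hK := hf.1
  have h0 : (0 : ℝ) ∈ Icc (0 : ℝ) 1 := left_mem_Icc.2 zero_le_one
  have h1 := hasDerivWithinAt_iff_tendsto_slope.1 (hasDerivWithinAt_segment hK hg hx hy h0)
  have e : (Icc (0 : ℝ) 1 \ {0}) = Ioc 0 1 := by simp
  rw [e, zero_smul, add_zero] at h1
  have h2 : Filter.Tendsto (fun s : ℝ => f y - f x - (1 - s) * (μ / 2 * ‖x - y‖ ^ 2))
      (𝓝[Ioc 0 1] 0) (𝓝 (f y - f x - (1 - 0) * (μ / 2 * ‖x - y‖ ^ 2))) :=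
    (Continuous.tendsto (by fun_prop) 0).mono_left nhdsWithin_le_nhds
  have : (𝓝[Ioc (0 : ℝ) 1] 0).NeBot := by
    rw [nhdsWithin_Ioc_eq_nhdsGT zero_lt_one]; infer_instance
  have h3 := le_of_tendsto_of_tendsto h1 h2 (by
    filter_upwards [self_mem_nhdsWithin] with s hs
    have h4 := hf.2 hx hy (sub_nonneg.2 hs.2) hs.1.le (by ring : 1 - s + s = 1)
    have e2 : (1 - s) • x + s • y = x + s • (y - x) := by
      rw [sub_smul, smul_sub, one_smul]; abel
    rw [e2] at h4
    simp only [smul_eq_mul] at h4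
    rw [slope_def_field]
    simp only [zero_smul, add_zero, sub_zero]
    rw [div_le_iff₀ hs.1]
    nlinarith)
  rw [norm_sub_rev x y] at h3
  linarith

/-- Add the first-order inequalities from x to z and from z to x: the function values cancel and the
two halves of μ combine. -/
lemma StrongConvexOn.le_inner_of_isMinOn (hf : StrongConvexOn K μ f)
    (hg : ∀ x ∈ K, HasGradientWithinAt f (g x) K x) {x z : Vec M} (hx : x ∈ K) (hz : z ∈ K)
    (hgz : g z = 0) : μ * ‖x - z‖ ^ 2 ≤ ⟪x - z, g x⟫ := by
  have h1 := StrongConvexOn.add_inner_le hf hg hx hz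
  have h2 := StrongConvexOn.add_inner_le hf hg hz hx
  rw [hgz, inner_zero_left] at h2
  rw [norm_sub_rev z x, ← neg_sub x z, inner_neg_right, real_inner_comm] at h1
  linarith

lemma gradient_eq_zero_of_isMinOn {z : Vec M} (hz : K ∈ 𝓝 z) (hmin : IsMinOn f K z)
    (hg : HasGradientWithinAt f (g z) K z) : g z = 0 := by
  have h1 := hg.hasFDerivWithinAt.hasFDerivAt hz
  have h2 : IsLocalMin f z := hmin.isLocalMin hz
  have h3 := h2.hasFDerivAt_eq_zero h1
  simpa using h3

end Convex

/-! ### Projections -/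

section Projection

open scoped RealInnerProductSpace

variable {M : ℕ} {s : Set (Vec M)}

lemma IsProj.inner_le_zero (hs : Convex ℝ s) {y x z : Vec M} (h : IsProj s y x) (hz : z ∈ s) :
    ⟪y - x, z - x⟫ ≤ 0 := by
  refine (norm_eq_iInf_iff_real_inner_le_zero hs h.1).1 ?_ z hz
  have : Nonempty s := ⟨⟨x, h.1⟩⟩
  apply le_antisymm
  · exact le_ciInf fun w => h.2 w w.2
  · exact ciInf_le ⟨0, by rintro _ ⟨w, rfl⟩; positivity⟩ (⟨x, h.1⟩ : s)

/-- The two variational inequalities add up to ‖x − x'‖² ≤ ⟪y − y', x − x'⟫; Cauchy–Schwarz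
finishes. -/
lemma IsProj.norm_sub_le_norm_sub (hs : Convex ℝ s) {y x y' x' : Vec M} (h : IsProj s y x)
    (h' : IsProj s y' x') : ‖x - x'‖ ≤ ‖y - y'‖ := by
  have h1 := h.inner_le_zero hs h'.1
  have h2 := h'.inner_le_zero hs h.1
  have h3 : ‖x - x'‖ ^ 2 ≤ ⟪y - y', x - x'⟫ := by
    rw [← real_inner_self_eq_norm_sq]
    have : ⟪y - y', x - x'⟫ - ⟪x - x', x - x'⟫ = -⟪y - x, x' - x⟫ - ⟪y' - x', x - x'⟫ := by
      rw [← inner_neg_right, ← inner_sub_left, neg_sub, ← inner_sub_left]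
      congr 1; abel
    linarith
  have h4 := real_inner_le_norm (y - y') (x - x')
  rcases eq_or_lt_of_le (norm_nonneg (x - x')) with h0 | h0
  · rw [← h0]; positivity
  · nlinarith

lemma isProj_self {z : Vec M} (hz : z ∈ s) : IsProj s z z :=
  ⟨hz, fun x' _ => by simp⟩

lemma IsProj.norm_sub_le (hs : Convex ℝ s) {y x z : Vec M} (h : IsProj s y x) (hz : z ∈ s) :
    ‖x - z‖ ≤ ‖y - z‖ :=
  h.norm_sub_le_norm_sub hs (isProj_self hz)

lemma IsProj.unique (hs : Convex ℝ s) {y x x' : Vec M} (h : IsProj s y x) (h' : IsProj s y x') :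
    x = x' := by
  have := h.norm_sub_le_norm_sub hs h'
  rw [sub_self, norm_zero] at this
  exact sub_eq_zero.1 (norm_le_zero_iff.1 this)

/-- Pointwise projections of a measurable map on a convex set (not necessarily closed) are
measurable. -/
lemma measurable_of_isProj {Ω : Type*} [MeasurableSpace Ω] (hs : Convex ℝ s) {y x : Ω → Vec M}
    (hy : Measurable y) (h : ∀ ω, IsProj s (y ω) (x ω)) : Measurable x := by
  let Y : Set (Vec M) := {v | ∃ w, IsProj s v w}
  let p : Y → Vec M := fun v => v.2.choose
  have hp : ∀ v : Y, IsProj s v (p v) := fun v => v.2.choose_spec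
  -- On the set Y of points possessing a nearest point the projection is nonexpansive, hence
  -- continuous on the subtype; neither closedness of s nor measurability of Y is needed.
  have hlip : LipschitzWith 1 p := LipschitzWith.of_dist_le_mul fun v w => by
    rw [dist_eq_norm, NNReal.coe_one, one_mul, Subtype.dist_eq, dist_eq_norm]
    exact (hp v).norm_sub_le_norm_sub hs (hp w)
  have hx : x = p ∘ fun ω => (⟨y ω, x ω, h ω⟩ : Y) := funext fun ω => (h ω).unique hs (hp _)
  rw [hx]
  exact hlip.continuous.measurable.comp (hy.subtype_mk)

end Projection

/-! ### Shrunken feasible sets -/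

section Shrink

variable {M : ℕ} {K : Set (Vec M)} {V : ℝ}

lemma shrink_convex (hK : Convex ℝ K) (b : ℝ) : Convex ℝ (shrink K V b) := by
  intro x hx y hy p q hp hq hpq v hv
  have := hK (hx v hv) (hy v hv) hp hq hpq
  convert this using 1
  rw [smul_add, smul_add, add_add_add_comm, ← add_smul, hpq, one_smul]

/-- For b > 0, b'v = b((b'/b)v) and the rescaled vector stays in the box. So the feasible sets grow
as β_t decreases, and a point feasible at one time remains feasible. -/
lemma shrink_anti {b b' : ℝ} (hb' : 0 ≤ b') (hb : b' ≤ b) : shrink K V b ⊆ shrink K V b' := by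
  intro x hx v hv
  rcases hb'.eq_or_lt with h0 | h0
  · subst h0
    rcases hb.eq_or_lt with h1 | h1
    · subst h1; exact hx v hv
    · have := hx 0 (fun m => by simpa using (abs_nonneg _).trans (hv m))
      simpa using this
  · have hbp : 0 < b := h0.trans_le hb
    have := hx ((b' / b) • v) fun m => by
      rw [PiLp.smul_apply, smul_eq_mul, abs_mul, abs_of_pos (div_pos h0 hbp)]
      exact (mul_le_of_le_one_left (abs_nonneg _) ((div_le_one hbp).2 hb)).trans (hv m)
    rwa [smul_smul, mul_div_cancel₀ _ hbp.ne'] at this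

lemma shrink_subset (hV : 0 ≤ V) (b : ℝ) : shrink K V b ⊆ K := fun x hx => by
  simpa using hx 0 (by simpa using fun _ => hV)

/-- Coordinates are bounded by the Euclidean norm, so the box around z contains the ball of radius
bV. This makes the minimizer an interior point. -/
lemma mem_nhds_of_mem_shrink {b : ℝ} (hV : 0 < V) (hb : 0 < b) {z : Vec M}
    (hz : z ∈ shrink K V b) : K ∈ nhds z := by
  rw [Metric.mem_nhds_iff]
  refine ⟨b * V, by positivity, fun y hy => ?_⟩
  have h1 := hz (b⁻¹ • (y - z)) fun m => by
    rw [PiLp.smul_apply, smul_eq_mul, abs_mul, abs_of_pos (inv_pos.2 hb), inv_mul_le_iff₀ hb]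
    rw [Metric.mem_ball, dist_eq_norm] at hy
    have := PiLp.norm_apply_le (y - z) m
    rw [Real.norm_eq_abs] at this
    exact this.trans hy.le
  rwa [smul_smul, mul_inv_cancel₀ hb.ne', one_smul, add_sub_cancel] at h1

end Shrink

open scoped RealInnerProductSpace

/-! ### Measurability and independence -/

section Independence

variable {Ω : Type*} {mΩ : MeasurableSpace Ω} {P : Measure Ω}

lemma measurable_comp_of_continuousOn {M : ℕ} {E : Type*} [TopologicalSpace E] [MeasurableSpace E]
    [BorelSpace E] {K : Set (Vec M)} {f : Vec M → E} (hf : ContinuousOn f K) {X : Ω → Vec M}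
    (hX : Measurable X) (hXK : ∀ ω, X ω ∈ K) : Measurable fun ω => f (X ω) := by
  have h1 : Measurable (K.domRestrict f) := (continuousOn_iff_continuous_domRestrict.1 hf).measurable
  exact h1.comp (hX.subtype_mk (h := hXK))

/-- Both hypotheses together say that the law of the triple is the product of the three marginals,
and products of measures can be reassociated. -/
lemma IndepFun.prodMk_left [IsProbabilityMeasure P] {α β γ : Type*} [MeasurableSpace α]
    [MeasurableSpace β] [MeasurableSpace γ] {X : Ω → α} {Y : Ω → β} {Z : Ω → γ}
    (hX : Measurable X) (hY : Measurable Y) (hZ : Measurable Z)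
    (h : IndepFun X (fun ω => (Y ω, Z ω)) P) (h' : IndepFun Y Z P) :
    IndepFun (fun ω => (X ω, Y ω)) Z P := by
  have hXY : IndepFun X Y P := h.comp measurable_id measurable_fst
  have := Measure.isProbabilityMeasure_map (μ := P) hX.aemeasurable
  have := Measure.isProbabilityMeasure_map (μ := P) hY.aemeasurable
  have := Measure.isProbabilityMeasure_map (μ := P) hZ.aemeasurable
  rw [indepFun_iff_map_prod_eq_prod_map_map (by fun_prop) (by fun_prop)] at h h' hXY ⊢
  rw [hXY]
  have e : (fun ω => ((X ω, Y ω), Z ω))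
      = MeasurableEquiv.prodAssoc.symm ∘ fun ω => (X ω, (Y ω, Z ω)) := rfl
  rw [e, ← Measure.map_map (MeasurableEquiv.measurable _) (by fun_prop), h, h',
    ← Measure.prodAssoc_prod, MeasurableEquiv.map_symm_map]

/-- A version of `IndepFun.comp` in which X' need not be written as a function of X, only be
measurable for the σ-algebra that X generates. -/
lemma indepFun_of_measurable_comap {α β γ : Type*} [MeasurableSpace α] [MeasurableSpace β]
    [MeasurableSpace γ] {X : Ω → α} {Y : Ω → β} {X' : Ω → γ} (h : IndepFun X Y P)
    (hX' : Measurable[MeasurableSpace.comap X inferInstance] X') : IndepFun X' Y P := by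
  rw [IndepFun_iff_Indep] at h ⊢
  exact indep_of_indep_of_le_left h (measurable_iff_comap_le.1 hX')

lemma integrable_of_bounded [IsFiniteMeasure P] {X : Ω → ℝ} (hX : Measurable X) {B : ℝ}
    (h : ∀ ω, |X ω| ≤ B) : Integrable X P :=
  Integrable.of_bound hX.aestronglyMeasurable B (ae_of_all _ h)

/-- Integrating out an independent sample. -/
lemma integral_mul_sample [IsProbabilityMeasure P] {α S : Type*} [MeasurableSpace α]
    [MeasurableSpace S] {X : Ω → α} {c : Ω → ℝ} {ξ : Ω → S} {F : α → S → ℝ} {B C : ℝ}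
    (hX : Measurable X) (hc : Measurable c) (hξ : Measurable ξ)
    (hF : Measurable fun p : α × S => F p.1 p.2) (hFC : ∀ x s, |F x s| ≤ C)
    (hcB : ∀ ω, |c ω| ≤ B) (h : IndepFun (fun ω => (X ω, c ω)) ξ P) :
    ∫ ω, c ω * F (X ω) (ξ ω) ∂P = ∫ ω, c ω * ∫ s, F (X ω) s ∂(P.map ξ) ∂P := by
  have hXc : Measurable fun ω => (X ω, c ω) := hX.prodMk hc
  have := Measure.isProbabilityMeasure_map (μ := P) hXc.aemeasurable
  have := Measure.isProbabilityMeasure_map (μ := P) hξ.aemeasurable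
  rw [indepFun_iff_map_prod_eq_prod_map_map hXc.aemeasurable hξ.aemeasurable] at h
  have hG : Measurable fun q : (α × ℝ) × S => q.1.2 * F q.1.1 q.2 := by
    have : Measurable fun q : (α × ℝ) × S => F q.1.1 q.2 :=
      hF.comp (measurable_fst.fst.prodMk measurable_snd)
    fun_prop
  have hint : Integrable (fun q : (α × ℝ) × S => q.1.2 * F q.1.1 q.2)
      ((P.map fun ω => (X ω, c ω)).prod (P.map ξ)) := by
    rw [← h]
    refine (integrable_map_measure hG.aestronglyMeasurable (hXc.prodMk hξ).aemeasurable).2 ?_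
    refine integrable_of_bounded (hG.comp (hXc.prodMk hξ)) (B := B * C) fun ω => ?_
    simp only [Function.comp_apply, abs_mul]
    exact mul_le_mul (hcB ω) (hFC _ _) (abs_nonneg _) ((abs_nonneg _).trans (hcB ω))
  have e1 : ∫ ω, c ω * F (X ω) (ξ ω) ∂P
      = ∫ q, q.1.2 * F q.1.1 q.2 ∂(P.map fun ω => ((X ω, c ω), ξ ω)) :=
    (integral_map (hXc.prodMk hξ).aemeasurable hG.aestronglyMeasurable).symm
  rw [e1, h, integral_prod _ hint]
  rw [integral_map hXc.aemeasurable hint.integral_prod_left.aestronglyMeasurable]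
  simp only [integral_const_mul]

end Independence

/-! ### Moments of the perturbations -/

section Moments

variable {Ω : Type*} {mΩ : MeasurableSpace Ω} {P : Measure Ω} [IsProbabilityMeasure P]
  {M : ℕ} {V : ℝ} {ν : Ω → Vec M}

lemma inner_eq_sum_mul (x y : Vec M) : ⟪x, y⟫ = ∑ m, x m * y m := by
  rw [PiLp.inner_apply]; simp [mul_comm]

lemma norm_le_of_abs_le (hV : 0 ≤ V) {v : Vec M} (hv : ∀ m, |v m| ≤ V) : ‖v‖ ≤ √M * V := by
  rw [EuclideanSpace.norm_eq]
  have h1 : ∑ m, ‖v m‖ ^ 2 ≤ M * V ^ 2 := by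
    refine (Finset.sum_le_sum fun m _ => pow_le_pow_left₀ (norm_nonneg _) (hv m) 2).trans ?_
    simp
  refine (Real.sqrt_le_sqrt h1).trans_eq ?_
  rw [Real.sqrt_mul (by positivity), Real.sqrt_sq hV]

lemma abs_apply_le_norm (v : Vec M) (m : Fin M) : |v m| ≤ ‖v‖ := by
  simpa using PiLp.norm_apply_le v m

lemma measurable_apply {u : Ω → Vec M} (hu : Measurable u) (m : Fin M) :
    Measurable fun ω => u ω m := by
  have : Continuous fun x : Vec M => x m := by fun_prop
  exact this.measurable.comp hu

/-- A perturbation independent of `u` is orthogonal to `u` in expectation. -/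
lemma integral_inner_eq_zero {u : Ω → Vec M} {B : ℝ} (hu : Measurable u) (huB : ∀ ω, ‖u ω‖ ≤ B)
    (hν : Measurable ν) (hνV : ∀ ω m, |ν ω m| ≤ V) (hmean : ∀ m, ∫ ω, ν ω m ∂P = 0)
    (h : IndepFun u ν P) : ∫ ω, ⟪u ω, ν ω⟫ ∂P = 0 := by
  simp only [inner_eq_sum_mul]
  have hum := measurable_apply hu
  have hνm := measurable_apply hν
  rw [integral_finsetSum]
  · refine Finset.sum_eq_zero fun m _ => ?_
    have hi : IndepFun (fun ω => u ω m) (fun ω => ν ω m) P :=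
      h.comp (measurable_apply measurable_id m) (measurable_apply measurable_id m)
    rw [hi.integral_fun_mul_eq_mul_integral (hum m).aestronglyMeasurable
      (hνm m).aestronglyMeasurable, hmean, mul_zero]
  · intro m _
    refine integrable_of_bounded ((hum m).mul (hνm m)) (B := B * V) fun ω => ?_
    simp only [abs_mul]
    exact mul_le_mul ((abs_apply_le_norm _ m).trans (huB ω)) (hνV ω m) (abs_nonneg _)
      ((norm_nonneg _).trans (huB ω))

/-- An isotropic perturbation reproduces the inner product in expectation. -/
lemma integral_inner_mul_inner {u w : Ω → Vec M} {B B' : ℝ} (hu : Measurable u)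
    (hw : Measurable w) (huB : ∀ ω, ‖u ω‖ ≤ B) (hwB : ∀ ω, ‖w ω‖ ≤ B')
    (hν : Measurable ν) (hνV : ∀ ω m, |ν ω m| ≤ V)
    (hcov : ∀ m m', ∫ ω, ν ω m * ν ω m' ∂P = if m = m' then 1 else 0)
    (h : IndepFun (fun ω => (u ω, w ω)) ν P) :
    ∫ ω, ⟪u ω, ν ω⟫ * ⟪w ω, ν ω⟫ ∂P = ∫ ω, ⟪u ω, w ω⟫ ∂P := by
  have hum := measurable_apply hu
  have hwm := measurable_apply hw
  have hνm := measurable_apply hν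
  have hb : ∀ ω m m', |u ω m * w ω m'| ≤ B * B' := fun ω m m' => by
    rw [abs_mul]
    exact mul_le_mul ((abs_apply_le_norm _ m).trans (huB ω)) ((abs_apply_le_norm _ m').trans (hwB ω))
      (abs_nonneg _) ((norm_nonneg _).trans (huB ω))
  have hint : ∀ m m', Integrable (fun ω => (u ω m * w ω m') * (ν ω m * ν ω m')) P := fun m m' => by
    refine integrable_of_bounded (B := (B * B') * (V * V))
      (((hum m).mul (hwm m')).mul ((hνm m).mul (hνm m'))) fun ω => ?_
    rw [abs_mul]
    refine mul_le_mul (hb ω m m') ?_ (abs_nonneg _) ((abs_nonneg _).trans (hb ω m m'))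
    rw [abs_mul]
    exact mul_le_mul (hνV ω m) (hνV ω m') (abs_nonneg _) ((abs_nonneg _).trans (hνV ω m))
  have e : ∀ ω, ⟪u ω, ν ω⟫ * ⟪w ω, ν ω⟫
      = ∑ m, ∑ m', (u ω m * w ω m') * (ν ω m * ν ω m') := fun ω => by
    rw [inner_eq_sum_mul, inner_eq_sum_mul, Finset.sum_mul_sum]
    exact Finset.sum_congr rfl fun m _ => Finset.sum_congr rfl fun m' _ => by ring
  simp only [e]
  rw [integral_finsetSum _ fun m _ => integrable_finsetSum _ fun m' _ => hint m m']
  simp only [inner_eq_sum_mul]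
  have hint' : ∀ m, Integrable (fun ω => u ω m * w ω m) P := fun m =>
    integrable_of_bounded ((hum m).mul (hwm m)) fun ω => hb ω m m
  rw [integral_finsetSum _ fun m _ => hint' m]
  refine Finset.sum_congr rfl fun m _ => ?_
  rw [integral_finsetSum _ fun m' _ => hint m m', Finset.sum_eq_single m]
  · have hi : IndepFun (fun ω => u ω m * w ω m) (fun ω => ν ω m * ν ω m) P :=
      h.comp (φ := fun p : Vec M × Vec M => p.1 m * p.2 m) (ψ := fun v : Vec M => v m * v m)
        ((measurable_apply measurable_fst m).mul (measurable_apply measurable_snd m))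
        ((measurable_apply measurable_id m).mul (measurable_apply measurable_id m))
    rw [hi.integral_fun_mul_eq_mul_integral ((hum m).mul (hwm m)).aestronglyMeasurable
      ((hνm m).mul (hνm m)).aestronglyMeasurable, hcov, if_pos rfl, mul_one]
  · intro m' _ hm
    have hi : IndepFun (fun ω => u ω m * w ω m') (fun ω => ν ω m * ν ω m') P :=
      h.comp (φ := fun p : Vec M × Vec M => p.1 m * p.2 m') (ψ := fun v : Vec M => v m * v m')
        ((measurable_apply measurable_fst m).mul (measurable_apply measurable_snd m'))
        ((measurable_apply measurable_id m).mul (measurable_apply measurable_id m'))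
    rw [hi.integral_fun_mul_eq_mul_integral ((hum m).mul (hwm m')).aestronglyMeasurable
      ((hνm m).mul (hνm m')).aestronglyMeasurable, hcov, if_neg hm.symm, mul_zero]
  · simp

lemma integral_norm_sq_perturbation (hν : Measurable ν) (hνV : ∀ ω m, |ν ω m| ≤ V)
    (hcov : ∀ m m', ∫ ω, ν ω m * ν ω m' ∂P = if m = m' then 1 else 0) :
    ∫ ω, ‖ν ω‖ ^ 2 ∂P = M := by
  have hνm := measurable_apply hν
  simp only [← real_inner_self_eq_norm_sq, inner_eq_sum_mul]
  have hint : ∀ m, Integrable (fun ω => ν ω m * ν ω m) P := fun m => by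
    refine integrable_of_bounded ((hνm m).mul (hνm m)) (B := V * V) fun ω => ?_
    rw [abs_mul]
    exact mul_le_mul (hνV ω m) (hνV ω m) (abs_nonneg _) ((abs_nonneg _).trans (hνV ω m))
  rw [integral_finsetSum _ fun m _ => hint m]
  simp [hcov]

/-- A lower bound for the correlation of the single-point gradient estimate with a direction `h`
determined, like the current point `θ`, by a random element `H` independent of the inputs. -/
lemma integral_inner_gradEst_ge {S 𝓗 : Type*} [MeasurableSpace S] [MeasurableSpace 𝓗]
    {K : Set (Vec M)} (hK : Convex ℝ K) {F : Vec M → S → ℝ} {C L b B : ℝ}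
    (hF : Measurable fun p : K × S => F p.1 p.2) (hFC : ∀ x ∈ K, ∀ s, |F x s| ≤ C)
    {D : Measure S} {g : Vec M → Vec M}
    (hg : ∀ x ∈ K, HasGradientWithinAt (localCost F D) (g x) K x)
    (hL : ∀ x ∈ K, ∀ y ∈ K, ‖g x - g y‖ ≤ L * ‖x - y‖) (hL0 : 0 ≤ L)
    {B' : ℝ} (hgB : ∀ x ∈ K, ‖g x‖ ≤ B')
    (hV : 0 ≤ V) (hb : 0 < b) {θ h : Ω → Vec M} {ξ : Ω → S} {H : Ω → 𝓗} (hH : Measurable H)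
    (hθ : Measurable[MeasurableSpace.comap H inferInstance] θ)
    (hh : Measurable[MeasurableSpace.comap H inferInstance] h)
    (hθK : ∀ ω, θ ω ∈ shrink K V b) (hhB : ∀ ω, ‖h ω‖ ≤ B)
    (hν : Measurable ν) (hνV : ∀ ω m, |ν ω m| ≤ V) (hmean : ∀ m, ∫ ω, ν ω m ∂P = 0)
    (hcov : ∀ m m', ∫ ω, ν ω m * ν ω m' ∂P = if m = m' then 1 else 0)
    (hξ : Measurable ξ) (hξD : P.map ξ = D)
    (hHν : IndepFun H ν P) (hHνξ : IndepFun (fun ω => (H ω, ν ω)) ξ P) :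
    ∫ ω, ⟪h ω, g (θ ω)⟫ ∂P - b * L / 2 * (M * (√M * V)) * ∫ ω, ‖h ω‖ ∂P
      ≤ ∫ ω, ⟪h ω, gradEst F b (θ ω) (ν ω) (ξ ω)⟫ ∂P := by
  subst hξD
  set f := localCost F (P.map ξ) with hf
  have := Measure.isProbabilityMeasure_map (μ := P) hξ.aemeasurable
  have hθ' : Measurable θ := hθ.mono hH.comap_le le_rfl
  have hh' : Measurable h := hh.mono hH.comap_le le_rfl
  have hθK' : ∀ ω, θ ω ∈ K := fun ω => shrink_subset hV b (hθK ω)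
  have hXK : ∀ ω, θ ω + b • ν ω ∈ K := fun ω => hθK ω _ (hνV ω)
  have hfc : ContinuousOn f K := fun x hx => (hg x hx).hasFDerivWithinAt.continuousWithinAt
  have hgc : ContinuousOn g K := by
    refine LipschitzOnWith.continuousOn (K := L.toNNReal) (LipschitzOnWith.of_dist_le_mul ?_)
    intro x hx y hy
    rw [dist_eq_norm, dist_eq_norm, Real.coe_toNNReal _ hL0]
    exact hL x hx y hy
  have hfC : ∀ x ∈ K, |f x| ≤ C := fun x hx => by
    rw [hf, localCost, ← Real.norm_eq_abs]
    refine (norm_integral_le_of_norm_le_const (ae_of_all _ fun s => hFC x hx s)).trans ?_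
    simp
  have hB0 : ∀ ω : Ω, 0 ≤ B := fun ω => (norm_nonneg _).trans (hhB ω)
  have hνB : ∀ ω, ‖ν ω‖ ≤ √M * V := fun ω => norm_le_of_abs_le hV (hνV ω)
  have hinB : ∀ ω, |⟪h ω, ν ω⟫| ≤ B * (√M * V) := fun ω =>
    (abs_real_inner_le_norm _ _).trans (mul_le_mul (hhB ω) (hνB ω) (norm_nonneg _) (hB0 ω))
  have hinm : Measurable fun ω => ⟪h ω, ν ω⟫ := hh'.inner hν
  have hXm : Measurable fun ω => θ ω + b • ν ω := by fun_prop
  -- integrate out the sample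
  have h1 : ∫ ω, ⟪h ω, gradEst F b (θ ω) (ν ω) (ξ ω)⟫ ∂P
      = b⁻¹ * ∫ ω, ⟪h ω, ν ω⟫ * f (θ ω + b • ν ω) ∂P := by
    let X : Ω → K := fun ω => ⟨θ ω + b • ν ω, hXK ω⟩
    have hX : Measurable X := hXm.subtype_mk
    -- The evaluation point and the coefficient are both measurable for σ(H, ν), which is
    -- independent of the sample.
    have hind : IndepFun (fun ω => (X ω, ⟪h ω, ν ω⟫)) ξ P := by
      refine indepFun_of_measurable_comap hHνξ ?_
      set m := MeasurableSpace.comap (fun ω => (H ω, ν ω)) inferInstance with hm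
      have hle : MeasurableSpace.comap H inferInstance ≤ m :=
        measurable_iff_comap_le.1 (measurable_fst.comp (comap_measurable _))
      have hνm : Measurable[m] ν := measurable_snd.comp (comap_measurable fun ω => (H ω, ν ω))
      have hθm : Measurable[m] θ := hθ.mono hle le_rfl
      have hhm : Measurable[m] h := hh.mono hle le_rfl
      have h2 : Measurable[m] fun ω => θ ω + b • ν ω := hθm.add (hνm.const_smul b)
      exact (h2.subtype_mk (h := hXK)).prodMk (hhm.inner hνm)
    have h3 := integral_mul_sample (P := P) (F := fun (x : K) s => F x s) hX hinm hξ hF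
      (fun x s => hFC x x.2 s) hinB hind
    rw [← integral_const_mul]
    have h4 : ∀ ω, ⟪h ω, gradEst F b (θ ω) (ν ω) (ξ ω)⟫
        = b⁻¹ * (⟪h ω, ν ω⟫ * F (X ω) (ξ ω)) := fun ω => by
      rw [gradEst, real_inner_smul_right]; simp only [X]; ring
    simp only [h4]
    rw [integral_const_mul, integral_const_mul, h3]
    rfl
  rw [h1]
  -- moments
  have hfθ : Measurable[MeasurableSpace.comap H inferInstance] fun ω => f (θ ω) :=
    measurable_comp_of_continuousOn (mΩ := MeasurableSpace.comap H inferInstance) hfc hθ hθK'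
  have hgθ : Measurable[MeasurableSpace.comap H inferInstance] fun ω => g (θ ω) :=
    measurable_comp_of_continuousOn (mΩ := MeasurableSpace.comap H inferInstance) hgc hθ hθK'
  have hfh : Measurable[MeasurableSpace.comap H inferInstance] fun ω => f (θ ω) • h ω :=
    hfθ.smul hh
  have hgθ' : Measurable fun ω => g (θ ω) := measurable_comp_of_continuousOn hgc hθ' hθK'
  have hfh' : Measurable fun ω => f (θ ω) • h ω :=
    (measurable_comp_of_continuousOn hfc hθ' hθK').smul hh'
  have z1 : ∫ ω, ⟪f (θ ω) • h ω, ν ω⟫ ∂P = 0 := by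
    refine integral_inner_eq_zero (B := C * B) hfh' (fun ω => ?_) hν hνV
      hmean (indepFun_of_measurable_comap hHν hfh)
    rw [norm_smul]
    exact mul_le_mul (hfC _ (hθK' ω)) (hhB ω) (norm_nonneg _)
      ((abs_nonneg _).trans (hfC _ (hθK' ω)))
  have z2 : ∫ ω, ⟪h ω, ν ω⟫ * ⟪g (θ ω), ν ω⟫ ∂P = ∫ ω, ⟪h ω, g (θ ω)⟫ ∂P :=
    integral_inner_mul_inner hh' hgθ' hhB (fun ω => hgB _ (hθK' ω)) hν hνV hcov
      (indepFun_of_measurable_comap hHν (hh.prodMk hgθ))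
  have z3 : ∫ ω, ‖h ω‖ * ‖ν ω‖ ^ 2 ∂P = (∫ ω, ‖h ω‖ ∂P) * M := by
    have hi : IndepFun (fun ω => ‖h ω‖) (fun ω => ‖ν ω‖ ^ 2) P :=
      (indepFun_of_measurable_comap hHν hh).comp measurable_norm (measurable_norm.pow_const 2)
    rw [hi.integral_fun_mul_eq_mul_integral hh'.norm.aestronglyMeasurable
      (hν.norm.pow_const 2).aestronglyMeasurable, integral_norm_sq_perturbation hν hνV hcov]
  -- integrability
  have hν2 : ∀ ω, ‖ν ω‖ ^ 2 ≤ (√M * V) ^ 2 := fun ω => pow_le_pow_left₀ (norm_nonneg _) (hνB ω) 2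
  have i1 : Integrable (fun ω => ⟪f (θ ω) • h ω, ν ω⟫) P := by
    refine integrable_of_bounded (B := C * (B * (√M * V)))
      (hfh'.inner hν) fun ω => ?_
    rw [real_inner_smul_left, abs_mul]
    exact mul_le_mul (hfC _ (hθK' ω)) (hinB ω) (abs_nonneg _)
      ((abs_nonneg _).trans (hfC _ (hθK' ω)))
  have i2 : Integrable (fun ω => ⟪h ω, ν ω⟫ * ⟪g (θ ω), ν ω⟫) P := by
    refine integrable_of_bounded (B := (B * (√M * V)) * (B' * (√M * V)))
      (hinm.mul (hgθ'.inner hν)) fun ω => ?_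
    rw [abs_mul]
    refine mul_le_mul (hinB ω) ?_ (abs_nonneg _) ((abs_nonneg _).trans (hinB ω))
    exact (abs_real_inner_le_norm _ _).trans (mul_le_mul (hgB _ (hθK' ω)) (hνB ω) (norm_nonneg _)
      ((norm_nonneg _).trans (hgB _ (hθK' ω))))
  have i3 : Integrable (fun ω => ‖h ω‖ * ‖ν ω‖ ^ 2) P := by
    refine integrable_of_bounded (B := B * (√M * V) ^ 2)
      (hh'.norm.mul (hν.norm.pow_const 2)) fun ω => ?_
    rw [abs_of_nonneg (by positivity)]
    exact mul_le_mul (hhB ω) (hν2 ω) (by positivity) (hB0 ω)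
  have i4 : Integrable (fun ω => ⟪h ω, ν ω⟫ * f (θ ω + b • ν ω)) P := by
    refine integrable_of_bounded (B := (B * (√M * V)) * C)
      (hinm.mul (measurable_comp_of_continuousOn hfc hXm hXK)) fun ω => ?_
    rw [abs_mul]
    exact mul_le_mul (hinB ω) (hfC _ (hXK ω)) (abs_nonneg _) ((abs_nonneg _).trans (hinB ω))
  -- First-order Taylor expansion at θ. Only the factor ‖ν‖ from ⟪h, ν⟫ is bounded by √M V; the
  -- factor ‖ν‖² is kept because its expectation is exactly M. The remainder is thus linear in V
  -- instead of cubic.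
  have hpt : ∀ ω, ⟪f (θ ω) • h ω, ν ω⟫ + b * (⟪h ω, ν ω⟫ * ⟪g (θ ω), ν ω⟫)
      - b ^ 2 * L / 2 * (√M * V) * (‖h ω‖ * ‖ν ω‖ ^ 2) ≤ ⟪h ω, ν ω⟫ * f (θ ω + b • ν ω) := by
    intro ω
    have t1 := abs_sub_sub_inner_le hK hg hL (hθK' ω) (hXK ω)
    rw [add_sub_cancel_left, norm_smul, real_inner_smul_right, Real.norm_eq_abs,
      abs_of_pos hb] at t1
    set r := f (θ ω + b • ν ω) - f (θ ω) - b * ⟪g (θ ω), ν ω⟫ with hr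
    have t2 : |⟪h ω, ν ω⟫ * r| ≤ b ^ 2 * L / 2 * (√M * V) * (‖h ω‖ * ‖ν ω‖ ^ 2) := by
      rw [abs_mul]
      calc |⟪h ω, ν ω⟫| * |r| ≤ (‖h ω‖ * (√M * V)) * (L / 2 * (b * ‖ν ω‖) ^ 2) := by
            refine mul_le_mul ?_ t1 (abs_nonneg _) (by positivity)
            exact (abs_real_inner_le_norm _ _).trans
              (mul_le_mul_of_nonneg_left (hνB ω) (norm_nonneg _))
        _ = _ := by ring
    have t3 := (abs_le.1 t2).1
    have t4 : ⟪h ω, ν ω⟫ * f (θ ω + b • ν ω) = ⟪f (θ ω) • h ω, ν ω⟫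
        + b * (⟪h ω, ν ω⟫ * ⟪g (θ ω), ν ω⟫) + ⟪h ω, ν ω⟫ * r := by
      rw [real_inner_smul_left, hr]; ring
    linarith
  have i12 : Integrable (fun ω => ⟪f (θ ω) • h ω, ν ω⟫ + b * (⟪h ω, ν ω⟫ * ⟪g (θ ω), ν ω⟫)) P :=
    i1.add (i2.const_mul b)
  have i3' := i3.const_mul (b ^ 2 * L / 2 * (√M * V))
  have hI := integral_mono (i12.sub i3') i4 hpt
  simp only [Pi.sub_apply] at hI
  rw [integral_sub i12 i3', integral_add i1 (i2.const_mul b), integral_const_mul,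
    integral_const_mul, z1, z2, z3] at hI
  rw [← mul_le_mul_iff_right₀ hb, mul_inv_cancel_left₀ hb.ne']
  refine le_trans (le_of_eq ?_) hI
  ring

end Moments

/-! ### One averaging and descent step -/

section Step

variable {N : ℕ} {E : Type*} [NormedAddCommGroup E] [InnerProductSpace ℝ E]
  {A : Matrix (Fin N) (Fin N) ℝ}

lemma mix_sub (hA : A ∈ doublyStochastic ℝ (Fin N)) (x : Fin N → E) (z : E) (i : Fin N) :
    ∑ j, A i j • x j - z = ∑ j, A i j • (x j - z) := by
  simp only [smul_sub, Finset.sum_sub_distrib, ← Finset.sum_smul,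
    sum_row_of_mem_doublyStochastic hA i, one_smul]

lemma norm_mix_sub_le (hA : A ∈ doublyStochastic ℝ (Fin N)) {x : Fin N → E} {z : E} {r : ℝ}
    (h : ∀ j, ‖x j - z‖ ≤ r) (i : Fin N) : ‖∑ j, A i j • x j - z‖ ≤ r := by
  rw [mix_sub hA]
  calc ‖∑ j, A i j • (x j - z)‖ ≤ ∑ j, A i j * r := by
        refine (norm_sum_le _ _).trans (Finset.sum_le_sum fun j _ => ?_)
        rw [norm_smul, Real.norm_of_nonneg (nonneg_of_mem_doublyStochastic hA)]
        exact mul_le_mul_of_nonneg_left (h j) (nonneg_of_mem_doublyStochastic hA)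
    _ = r := by rw [← Finset.sum_mul, sum_row_of_mem_doublyStochastic hA i, one_mul]

/-- Jensen along each row, then the column sums. -/
lemma sum_norm_sq_mix_le (hA : A ∈ doublyStochastic ℝ (Fin N)) (x : Fin N → E) (z : E) :
    ∑ i, ‖∑ j, A i j • x j - z‖ ^ 2 ≤ ∑ i, ‖x i - z‖ ^ 2 := by
  have h1 : ∀ i, ‖∑ j, A i j • x j - z‖ ^ 2 ≤ ∑ j, A i j * ‖x j - z‖ ^ 2 := fun i => by
    rw [mix_sub hA]
    have hc : ConvexOn ℝ Set.univ fun v : E => ‖v‖ ^ 2 :=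
      convexOn_univ_norm.pow (fun _ _ => norm_nonneg _) 2
    have := hc.map_sum_le (t := Finset.univ) (w := fun j => A i j) (p := fun j => x j - z)
      (fun j _ => nonneg_of_mem_doublyStochastic hA) (sum_row_of_mem_doublyStochastic hA i)
      (fun _ _ => Set.mem_univ _)
    simpa using this
  refine (Finset.sum_le_sum fun i _ => h1 i).trans_eq ?_
  rw [Finset.sum_comm]
  refine Finset.sum_congr rfl fun j _ => ?_
  rw [← Finset.sum_mul, sum_col_of_mem_doublyStochastic hA j, one_mul]

/-- Expanding the square produces node-dependent directions y_i − z. Replacing them by the common c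
− z costs rδ per node, and only against a common direction do the local gradients add up to the
gradient of f. -/
lemma sum_norm_sq_step_le (hA : A ∈ doublyStochastic ℝ (Fin N)) {x x' g : Fin N → E} {z c : E}
    {α δ r : ℝ} (hr : ∀ i, ‖x i - c‖ ≤ r) (hδ : ∀ i, ‖α • g i‖ ≤ δ)
    (hx' : ∀ i, ‖x' i - z‖ ≤ ‖∑ j, A i j • x j - α • g i - z‖) :
    ∑ i, ‖x' i - z‖ ^ 2 ≤ ∑ i, ‖x i - z‖ ^ 2 - 2 * α * ∑ i, ⟪c - z, g i⟫
      + N * (δ ^ 2 + 2 * r * δ) := by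
  have h1 : ∀ i, ‖x' i - z‖ ^ 2 ≤ ‖∑ j, A i j • x j - z‖ ^ 2 - 2 * α * ⟪c - z, g i⟫
      + (δ ^ 2 + 2 * r * δ) := fun i => by
    refine (pow_le_pow_left₀ (norm_nonneg _) (hx' i) 2).trans ?_
    set y := ∑ j, A i j • x j with hy
    have hyr : ‖y - c‖ ≤ r := norm_mix_sub_le hA hr i
    have e1 : y - α • g i - z = (y - z) - α • g i := by abel
    have e2 : y - z = (y - c) + (c - z) := by abel
    rw [e1, norm_sub_sq_real]
    have e3 : ⟪y - z, α • g i⟫ = ⟪y - c, α • g i⟫ + α * ⟪c - z, g i⟫ := by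
      rw [e2, inner_add_left, real_inner_smul_right (c - z)]
    rw [e3]
    have h2 : -(r * δ) ≤ ⟪y - c, α • g i⟫ := by
      have h3 := (abs_le.1 (abs_real_inner_le_norm (y - c) (α • g i))).1
      have h4 := mul_le_mul hyr (hδ i) (norm_nonneg _) ((norm_nonneg _).trans hyr)
      linarith
    have h5 : ‖α • g i‖ ^ 2 ≤ δ ^ 2 := pow_le_pow_left₀ (norm_nonneg _) (hδ i) 2
    linarith
  refine (Finset.sum_le_sum fun i _ => h1 i).trans ?_
  rw [Finset.sum_add_distrib, Finset.sum_sub_distrib, ← Finset.mul_sum]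
  have := sum_norm_sq_mix_le hA x z
  simp only [Finset.sum_const, Finset.card_univ, Fintype.card_fin, nsmul_eq_mul]
  linarith

/-- The mean of `N` vectors. -/
def mean (x : Fin N → E) : E := (1 / N : ℝ) • ∑ j, x j

lemma sum_sub_mean (hN : N ≠ 0) (x : Fin N → E) : ∑ i, (x i - mean x) = 0 := by
  rw [Finset.sum_sub_distrib, mean, Finset.sum_const, Finset.card_univ, Fintype.card_fin,
    ← Nat.cast_smul_eq_nsmul ℝ, smul_smul, mul_one_div_cancel (by exact_mod_cast hN), one_smul,
    sub_self]

/-- The cross terms vanish because deviations from the mean sum to zero. -/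
lemma sum_norm_sq_eq (hN : N ≠ 0) (x : Fin N → E) (z : E) :
    ∑ i, ‖x i - z‖ ^ 2 = N * ‖mean x - z‖ ^ 2 + ∑ i, ‖x i - mean x‖ ^ 2 := by
  have h1 : ∀ i, ‖x i - z‖ ^ 2
      = ‖x i - mean x‖ ^ 2 + 2 * ⟪x i - mean x, mean x - z⟫ + ‖mean x - z‖ ^ 2 := fun i => by
    rw [← norm_add_sq_real, sub_add_sub_cancel]
  simp only [h1, Finset.sum_add_distrib, ← Finset.mul_sum, ← sum_inner, sum_sub_mean hN,
    inner_zero_left, Finset.sum_const, Finset.card_univ, Fintype.card_fin, nsmul_eq_mul]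
  ring

/-- Local gradients at nearly equal points add up to a strongly monotone direction. -/
lemma sum_inner_gradient_ge (hN : N ≠ 0) {K : Set E} {g : Fin N → E → E}
    {Li : Fin N → ℝ} {L μ r : ℝ} (hμ : 0 ≤ μ) (hLi : ∀ i, 0 ≤ Li i) (hL : L = (∑ i, Li i) / N)
    (hg : ∀ i, ∀ x ∈ K, ∀ y ∈ K, ‖g i x - g i y‖ ≤ Li i * ‖x - y‖) {z : E}
    (hmono : ∀ x ∈ K, μ * ‖x - z‖ ^ 2 ≤ ⟪x - z, mean fun i => g i x⟫) {x : Fin N → E}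
    (hx : ∀ i, x i ∈ K) (hmean : mean x ∈ K) (hr : ∀ i, ‖x i - mean x‖ ≤ r) :
    μ * (∑ i, ‖x i - z‖ ^ 2 - N * r ^ 2) - N * L * r * ‖mean x - z‖
      ≤ ∑ i, ⟪mean x - z, g i (x i)⟫ := by
  have hN' : (N : ℝ) ≠ 0 := by exact_mod_cast hN
  have h1 : ∑ i, ⟪mean x - z, g i (mean x)⟫ = N * ⟪mean x - z, mean fun i => g i (mean x)⟫ := by
    rw [mean.eq_def fun i => g i (mean x), inner_smul_right, ← inner_sum, ← mul_assoc,
      mul_one_div_cancel hN', one_mul]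
  have h2 : ∀ i, ⟪mean x - z, g i (mean x)⟫ - Li i * (r * ‖mean x - z‖)
      ≤ ⟪mean x - z, g i (x i)⟫ := fun i => by
    have h3 : |⟪mean x - z, g i (x i) - g i (mean x)⟫| ≤ Li i * (r * ‖mean x - z‖) := by
      refine (abs_real_inner_le_norm _ _).trans ?_
      have h4 := (hg i _ (hx i) _ hmean).trans (mul_le_mul_of_nonneg_left (hr i) (hLi i))
      calc _ ≤ ‖mean x - z‖ * (Li i * r) := mul_le_mul_of_nonneg_left h4 (norm_nonneg _)
        _ = _ := by ring
    rw [inner_sub_right] at h3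
    linarith [(abs_le.1 h3).1]
  have h5 := Finset.sum_le_sum fun i (_ : i ∈ Finset.univ) => h2 i
  rw [Finset.sum_sub_distrib, h1, ← Finset.sum_mul] at h5
  have h6 : ∑ i, Li i = N * L := by rw [hL]; field_simp
  rw [h6] at h5
  -- Strong monotonicity holds at the mean; this decomposition turns N‖mean − z‖² into the full sum
  -- at a cost of at most N r².
  have h7 := sum_norm_sq_eq hN x z
  have h8 : ∑ i, ‖x i - mean x‖ ^ 2 ≤ N * r ^ 2 := by
    refine (Finset.sum_le_sum fun i _ => pow_le_pow_left₀ (norm_nonneg _) (hr i) 2).trans ?_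
    simp
  have h9 := mul_le_mul_of_nonneg_left (hmono _ hmean) (Nat.cast_nonneg N : (0 : ℝ) ≤ N)
  have h10 : μ * (∑ i, ‖x i - z‖ ^ 2 - N * r ^ 2) ≤ μ * (N * ‖mean x - z‖ ^ 2) :=
    mul_le_mul_of_nonneg_left (by linarith) hμ
  linarith

end Step

/-! ### The iterates -/

section Run

variable {N M : ℕ} {Ω : Type*} {S : Fin N → Type*}
  {A : ℕ → Matrix (Fin N) (Fin N) ℝ} {a : ℝ} {τ : ℕ} {K : Set (Vec M)} {V C R : ℝ} {α β : ℕ → ℝ}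
  {F : ∀ i, Vec M → S i → ℝ} {ν : Fin N → ℕ → Ω → Vec M} {ξ : ∀ i, ℕ → Ω → S i}
  {θ : Fin N → ℕ → Ω → Vec M}

lemma IsRun.mem_shrink (h : IsRun A K V α β F ν ξ θ) (h0 : (0 : Vec M) ∈ shrink K V (β 1))
    {t : ℕ} (ht : 1 ≤ t) (i : Fin N) (ω : Ω) : θ i t ω ∈ shrink K V (β t) := by
  obtain ⟨t, rfl⟩ := Nat.exists_eq_add_of_le' ht
  rcases Nat.eq_zero_or_pos t with rfl | ht'
  · rw [zero_add, h.init]; exact h0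
  · exact (h.step i t ht' ω).1

lemma norm_gradEst_le {S : Type*} {F : Vec M → S → ℝ} (hFC : ∀ x ∈ K, ∀ s, |F x s| ≤ C)
    (hV : 0 ≤ V) {b : ℝ} (hb : 0 < b) {x v : Vec M} {s : S} (hx : x ∈ shrink K V b)
    (hv : ∀ m, |v m| ≤ V) : ‖gradEst F b x v s‖ ≤ √M * V * C / b := by
  rw [gradEst, norm_smul, norm_div, Real.norm_eq_abs, Real.norm_eq_abs, abs_of_pos hb]
  have h1 := mul_le_mul (hFC _ (hx v hv) s) (norm_le_of_abs_le hV hv) (norm_nonneg _)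
    ((abs_nonneg _).trans (hFC _ (hx v hv) s))
  calc |F (x + b • v) s| / b * ‖v‖ = |F (x + b • v) s| * ‖v‖ / b := by ring
    _ ≤ C * (√M * V) / b := div_le_div_of_nonneg_right h1 hb.le
    _ = _ := by ring

lemma measurable_gradEst {mΩ : MeasurableSpace Ω} {S : Type*} [MeasurableSpace S]
    {F : Vec M → S → ℝ} (hF : Measurable fun p : K × S => F p.1 p.2) {b : ℝ} {x v : Ω → Vec M}
    {s : Ω → S} (hx : Measurable x) (hv : Measurable v) (hs : Measurable s)
    (hK : ∀ ω, x ω + b • v ω ∈ K) : Measurable fun ω => gradEst F b (x ω) (v ω) (s ω) := by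
  have h1 : Measurable fun ω => x ω + b • v ω := hx.add (hv.const_smul b)
  have h2 : Measurable fun ω => F (x ω + b • v ω) (s ω) :=
    hF.comp ((h1.subtype_mk (h := hK)).prodMk hs)
  exact (h2.div_const b).smul hv

/-- The σ-algebra on Ω is a parameter, so that the lemma applies to `past ν ξ (t + 1)` and shows the
iterates to be adapted. -/
lemma IsRun.measurable_step {mΩ : MeasurableSpace Ω} [∀ i, MeasurableSpace (S i)]
    (h : IsRun A K V α β F ν ξ θ) (hK : Convex ℝ K) (h0 : (0 : Vec M) ∈ shrink K V (β 1))
    (hF : ∀ i, Measurable fun p : K × S i => F i p.1 p.2) {t : ℕ} (ht : 1 ≤ t)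
    (hνV : ∀ i ω m, |ν i t ω m| ≤ V) (hθ : ∀ i, Measurable (θ i t))
    (hν : ∀ i, Measurable (ν i t)) (hξ : ∀ i, Measurable (ξ i t)) (i : Fin N) :
    Measurable (θ i (t + 1)) := by
  refine measurable_of_isProj (shrink_convex hK _) ?_ (h.step i t ht)
  refine Measurable.sub ?_ ?_
  · exact Finset.measurable_fun_sum _ fun j _ => (hθ j).fun_const_smul _
  · exact (measurable_gradEst (hF i) (hθ i) (hν i) (hξ i) fun ω =>
      h.mem_shrink h0 ht i ω _ (hνV i ω)).fun_const_smul _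

/-- The joint input of all nodes at time `t`. -/
def input (ν : Fin N → ℕ → Ω → Vec M) (ξ : ∀ i, ℕ → Ω → S i) (t : ℕ) (ω : Ω) :
    (Fin N → Vec M) × (∀ i, S i) :=
  (fun i => ν i t ω, fun i => ξ i t ω)

/-- The information available before time `t`. -/
@[reducible]
def past [∀ i, MeasurableSpace (S i)] (ν : Fin N → ℕ → Ω → Vec M) (ξ : ∀ i, ℕ → Ω → S i)
    (t : ℕ) : MeasurableSpace Ω :=
  ⨆ s ∈ Set.Iio t, MeasurableSpace.comap (input ν ξ s) inferInstance

lemma past_mono [∀ i, MeasurableSpace (S i)] {s t : ℕ} (h : s ≤ t) : past ν ξ s ≤ past ν ξ t :=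
  biSup_mono fun _ hr => lt_of_lt_of_le hr h

lemma measurable_input_past [∀ i, MeasurableSpace (S i)] (t : ℕ) :
    Measurable[past ν ξ (t + 1)] (input ν ξ t) :=
  measurable_iff_comap_le.2 (le_biSup (fun s => MeasurableSpace.comap (input ν ξ s) inferInstance)
    (Set.mem_Iio.2 t.lt_succ_self))

lemma IsRun.measurable_past [∀ i, MeasurableSpace (S i)] (h : IsRun A K V α β F ν ξ θ)
    (hK : Convex ℝ K) (h0 : (0 : Vec M) ∈ shrink K V (β 1))
    (hF : ∀ i, Measurable fun p : K × S i => F i p.1 p.2)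
    (hνV : ∀ i t, 1 ≤ t → ∀ ω m, |ν i t ω m| ≤ V) {t : ℕ} (ht : 1 ≤ t) (i : Fin N) :
    Measurable[past ν ξ t] (θ i t) := by
  induction t, ht using Nat.le_induction generalizing i with
  | base =>
    have : θ i 1 = fun _ => 0 := funext (h.init i)
    rw [this]; exact measurable_const
  | succ t ht ih =>
    have hz := measurable_input_past (ν := ν) (ξ := ξ) t
    refine h.measurable_step (mΩ := past ν ξ (t + 1)) hK h0 hF ht (fun i => hνV i t ht)
      (fun j => (ih j).mono (past_mono (Nat.le_succ t)) le_rfl) (fun j => ?_) (fun j => ?_) i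
    · exact (measurable_pi_apply j).comp (measurable_fst.comp hz)
    · exact (measurable_pi_apply j).comp (measurable_snd.comp hz)

section Probability

variable {mΩ : MeasurableSpace Ω} {P : Measure Ω}
  [∀ i, MeasurableSpace (S i)] {D : ∀ i, Measure (S i)}

lemma measurable_input (hν : ∀ i t, Measurable (ν i t)) (hξ : ∀ i t, Measurable (ξ i t)) (t : ℕ) :
    Measurable (input ν ξ t) :=
  (measurable_pi_lambda _ fun i => hν i t).prodMk (measurable_pi_lambda _ fun i => hξ i t)

lemma past_le (hν : ∀ i t, Measurable (ν i t)) (hξ : ∀ i t, Measurable (ξ i t)) (t : ℕ) :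
    past ν ξ t ≤ mΩ :=
  iSup₂_le fun s _ => (measurable_input hν hξ s).comap_le

/-- The iterates at time t are functions of inputs at strictly earlier times, and inputs at
different times are independent. -/
lemma IsRun.indepFun_input (h : IsRun A K V α β F ν ξ θ) (hK : Convex ℝ K)
    (h0 : (0 : Vec M) ∈ shrink K V (β 1)) (hF : ∀ i, Measurable fun p : K × S i => F i p.1 p.2)
    (hp : Perturbation P V ν) (hs : Sampling P D ν ξ) {t : ℕ} (ht : 1 ≤ t) :
    IndepFun (fun ω i => θ i t ω) (input ν ξ t) P := by
  have h1 : iIndep (fun t => MeasurableSpace.comap (input ν ξ t) inferInstance) P :=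
    hs.indep_time.iIndep
  have h2 : Indep (past ν ξ t)
      (⨆ s ∈ ({t} : Set ℕ), MeasurableSpace.comap (input ν ξ s) inferInstance) P :=
    indep_iSup_of_disjoint (fun s => (measurable_input hp.measurable hs.measurable s).comap_le) h1
      (by simp)
  rw [iSup_singleton] at h2
  rw [IndepFun_iff_Indep]
  refine indep_of_indep_of_le_left h2 (measurable_iff_comap_le.1 ?_)
  exact @measurable_pi_lambda _ _ _ (past ν ξ t) _ _ fun i =>
    h.measurable_past hK h0 hF hp.abs_le ht i

/-- The correlation of the gradient estimate of one node with the current average direction. -/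
lemma IsRun.integral_inner_gradEst_ge [IsProbabilityMeasure P] (h : IsRun A K V α β F ν ξ θ) (hK : Feasible K R)
    (h0 : (0 : Vec M) ∈ shrink K V (β 1)) (hV : 0 ≤ V)
    (hF : ∀ i, Measurable fun p : K × S i => F i p.1 p.2)
    (hFC : ∀ i, ∀ x ∈ K, ∀ s, |F i x s| ≤ C)
    (hp : Perturbation P V ν) (hs : Sampling P D ν ξ) {g : Fin N → Vec M → Vec M}
    (hg : ∀ i, ∀ x ∈ K, HasGradientWithinAt (localCost (F i) (D i)) (g i x) K x)
    {Li : Fin N → ℝ} (hLi : ∀ i, 0 ≤ Li i)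
    (hgL : ∀ i, ∀ x ∈ K, ∀ y ∈ K, ‖g i x - g i y‖ ≤ Li i * ‖x - y‖)
    {t : ℕ} (ht : 1 ≤ t) (hβ : 0 < β t) {z : Vec M} {B : ℝ}
    (hB : ∀ ω, ‖(mean fun i => θ i t ω) - z‖ ≤ B) (i : Fin N) :
    ∫ ω, ⟪(mean fun i => θ i t ω) - z, g i (θ i t ω)⟫ ∂P
        - β t * Li i / 2 * (M * (√M * V)) * ∫ ω, ‖(mean fun i => θ i t ω) - z‖ ∂P
      ≤ ∫ ω, ⟪(mean fun i => θ i t ω) - z,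
          gradEst (F i) (β t) (θ i t ω) (ν i t ω) (ξ i t ω)⟫ ∂P := by
  have hind := h.indepFun_input hK.convex h0 hF hp hs ht
  have hHm : ∀ j, Measurable (θ j t) := fun j =>
    (h.measurable_past hK.convex h0 hF hp.abs_le ht j).mono
      (past_le hp.measurable hs.measurable t) le_rfl
  have hH : Measurable fun ω i => θ i t ω := measurable_pi_lambda _ hHm
  have hmean : Measurable fun x : Fin N → Vec M => mean x - z := by
    unfold mean
    exact ((Finset.measurable_fun_sum _ fun j _ => measurable_pi_apply j).const_smul
      (1 / N : ℝ)).sub_const z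
  have hcm : Measurable[MeasurableSpace.comap (fun ω i => θ i t ω) inferInstance]
    fun ω i => θ i t ω := comap_measurable _
  refine DZOSCO.integral_inner_gradEst_ge (H := fun ω i => θ i t ω) hK.convex (hF i) (hFC i)
    (hg i) (hgL i) (hLi i) (B' := ‖g i 0‖ + Li i * R) (fun x hx => ?_) hV hβ hH
    ((measurable_pi_apply i).comp hcm) (hmean.comp hcm) (h.mem_shrink h0 ht i) hB
    (hp.measurable i t) (hp.abs_le i t ht) (hp.mean i t ht) (hp.covariance i t ht)
    (hs.measurable i t) (hs.law i t ht) ?_ ?_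
  · have h1 := hgL i x hx 0 hK.zero_mem
    rw [sub_zero] at h1
    have h2 := mul_le_mul_of_nonneg_left (hK.norm_le x hx) (hLi i)
    have h3 := norm_le_norm_add_norm_sub' (g i x) (g i 0)
    linarith
  · exact hind.comp measurable_id ((measurable_pi_apply i).comp measurable_fst)
  -- Iterates are independent of the whole input (ν, ξ), and ν is independent of ξ; so iterates and
  -- ν jointly are independent of ξ.
  · have h3 := IndepFun.prodMk_left (P := P) hH
      (measurable_pi_lambda _ fun i => hp.measurable i t)
      (measurable_pi_lambda _ fun i => hs.measurable i t) hind (hs.indep_perturbation t ht)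
    exact h3.comp (φ := fun q : (Fin N → Vec M) × (Fin N → Vec M) => (q.1, q.2 i))
      (ψ := fun q : ∀ i, S i => q i)
      (measurable_fst.prodMk ((measurable_pi_apply i).comp measurable_snd)) (measurable_pi_apply i)

end Probability

end Run

/-! ### Disagreement of the nodes and the recursion for the expected squared distance -/

section Recursion

variable {N M : ℕ} {Ω : Type*} {S : Fin N → Type*}
  {A : ℕ → Matrix (Fin N) (Fin N) ℝ} {a : ℝ} {τ : ℕ} {K : Set (Vec M)} {V C R : ℝ} {α β : ℕ → ℝ}
  {F : ∀ i, Vec M → S i → ℝ} {ν : Fin N → ℕ → Ω → Vec M} {ξ : ∀ i, ℕ → Ω → S i}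
  {θ : Fin N → ℕ → Ω → Vec M}

lemma IsRun.norm_smul_gradEst_le (h : IsRun A K V α β F ν ξ θ)
    (h0 : (0 : Vec M) ∈ shrink K V (β 1)) (hV : 0 ≤ V) (hFC : ∀ i, ∀ x ∈ K, ∀ s, |F i x s| ≤ C)
    (hνV : ∀ i t, 1 ≤ t → ∀ ω m, |ν i t ω m| ≤ V) {t : ℕ} (ht : 1 ≤ t) (hα : 0 ≤ α t)
    (hβ : 0 < β t) (i : Fin N) (ω : Ω) :
    ‖α t • gradEst (F i) (β t) (θ i t ω) (ν i t ω) (ξ i t ω)‖ ≤ √M * V * C * (α t / β t) := by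
  rw [norm_smul, Real.norm_of_nonneg hα]
  refine (mul_le_mul_of_nonneg_left (norm_gradEst_le (hFC i) hV hβ (h.mem_shrink h0 ht i ω)
    (hνV i t ht ω)) hα).trans_eq ?_
  ring

lemma IsRun.norm_sub_mean_le_sum (h : IsRun A K V α β F ν ξ θ) (hA : Network A a τ) (hN : 2 ≤ N)
    (hτ : 1 ≤ τ) (ha : 0 < a) (hK : Convex ℝ K) (h0 : (0 : Vec M) ∈ shrink K V (β 1))
    (hV : 0 ≤ V) (hFC : ∀ i, ∀ x ∈ K, ∀ s, |F i x s| ≤ C)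
    (hνV : ∀ i t, 1 ≤ t → ∀ ω m, |ν i t ω m| ≤ V) (hα : ∀ t, 1 ≤ t → 0 ≤ α t)
    (hβ : ∀ t, 1 ≤ t → 0 < β t) (hβ' : ∀ t, 1 ≤ t → β (t + 1) ≤ β t) (n : ℕ) (i : Fin N) (ω : Ω) :
    ‖θ i (n + 1) ω - mean fun j => θ j (n + 1) ω‖ ≤ N * (rho N τ a / 2)
      * ∑ s ∈ Finset.range n,
          eta N τ a ^ (n - 1 - s) * (√M * V * C * (α (s + 1) / β (s + 1))) := by
  refine hA.norm_iterate_sub_average_le hN hτ ha (x := fun t i => θ i t ω)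
    (e := fun t i => θ i (t + 1) ω - ∑ j, A t i j • θ j t ω)
    (ε := fun t => √M * V * C * (α t / β t)) (fun i => h.init i ω) (fun t _ i => by abel)
    (fun t ht i => ?_) n i
  -- The mixed value is already feasible for the next step, so projecting moves the new iterate no
  -- further from it than the gradient step did.
  have hy : ∑ j, A t i j • θ j t ω ∈ shrink K V (β (t + 1)) := by
    refine shrink_anti (hβ _ (by omega)).le (hβ' t ht) ?_
    exact (shrink_convex hK _).sum_mem (fun j _ => hA.nonneg t i j)
      (sum_row_of_mem_doublyStochastic (hA.doublyStochastic t) i)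
      fun j _ => h.mem_shrink h0 ht j ω
  refine ((h.step i t ht ω).norm_sub_le (shrink_convex hK _) hy).trans ?_
  rw [sub_sub_cancel_left, norm_neg]
  exact h.norm_smul_gradEst_le h0 hV hFC hνV ht (hα t ht) (hβ t ht) i ω

lemma IsRun.mem (h : IsRun A K V α β F ν ξ θ) (h0 : (0 : Vec M) ∈ shrink K V (β 1)) (hV : 0 ≤ V)
    {t : ℕ} (ht : 1 ≤ t) (i : Fin N) (ω : Ω) : θ i t ω ∈ K :=
  shrink_subset hV _ (h.mem_shrink h0 ht i ω)

lemma mean_mem (hN : N ≠ 0) (hK : Convex ℝ K) {x : Fin N → Vec M} (hx : ∀ i, x i ∈ K) :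
    mean x ∈ K := by
  rw [mean, Finset.smul_sum]
  refine hK.sum_mem (fun _ _ => by positivity) ?_ fun i _ => hx i
  have : (N : ℝ) ≠ 0 := by exact_mod_cast hN
  simp [this]

lemma Feasible.norm_sub_le (hK : Feasible K R) {x y : Vec M} (hx : x ∈ K) (hy : y ∈ K) :
    ‖x - y‖ ≤ 2 * R := by
  have := _root_.norm_sub_le x y
  linarith [hK.norm_le x hx, hK.norm_le y hy]

variable {mΩ : MeasurableSpace Ω} {P : Measure Ω} [∀ i, MeasurableSpace (S i)]
  {D : ∀ i, Measure (S i)}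

lemma IsRun.measurable (h : IsRun A K V α β F ν ξ θ) (hK : Convex ℝ K)
    (h0 : (0 : Vec M) ∈ shrink K V (β 1)) (hF : ∀ i, Measurable fun p : K × S i => F i p.1 p.2)
    (hp : Perturbation P V ν) (hs : Sampling P D ν ξ) {t : ℕ} (ht : 1 ≤ t) (i : Fin N) :
    Measurable (θ i t) :=
  (h.measurable_past hK h0 hF hp.abs_le ht i).mono (past_le hp.measurable hs.measurable t) le_rfl

lemma measurable_mean {x : Fin N → Ω → Vec M} (hx : ∀ i, Measurable (x i)) :
    Measurable fun ω => mean fun i => x i ω := by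
  unfold mean
  exact (Finset.measurable_fun_sum _ fun j _ => hx j).fun_const_smul _

variable [IsProbabilityMeasure P]

/-- The expected squared distance of all nodes to `z` at time `t`. -/
def meanSqDist (P : Measure Ω) (θ : Fin N → ℕ → Ω → Vec M) (z : Vec M) (t : ℕ) : ℝ :=
  ∫ ω, ∑ i, ‖θ i t ω - z‖ ^ 2 ∂P

lemma integrable_norm_sq {x : Ω → Vec M} {z : Vec M} (hx : Measurable x) {B : ℝ}
    (hB : ∀ ω, ‖x ω - z‖ ≤ B) : Integrable (fun ω => ‖x ω - z‖ ^ 2) P :=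
  integrable_of_bounded ((hx.sub_const z).norm.pow_const 2) (B := B ^ 2) fun ω => by
    rw [abs_of_nonneg (by positivity)]
    exact pow_le_pow_left₀ (norm_nonneg _) (hB ω) 2

lemma sq_integral_le_integral_sq {X : Ω → ℝ} (hX : Measurable X) {B : ℝ} (hB : ∀ ω, |X ω| ≤ B) :
    (∫ ω, X ω ∂P) ^ 2 ≤ ∫ ω, X ω ^ 2 ∂P := by
  have h1 : Integrable X P := integrable_of_bounded hX hB
  have h2 : Integrable (fun ω => X ω ^ 2) P :=
    integrable_of_bounded (hX.pow_const 2) (B := B ^ 2) fun ω => by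
      rw [abs_pow]; exact pow_le_pow_left₀ (abs_nonneg _) (hB ω) 2
  set e := ∫ ω, X ω ∂P with he
  have h3 : 0 ≤ ∫ ω, (X ω - e) ^ 2 ∂P := integral_nonneg fun ω => by positivity
  have h4 : ∀ ω, (X ω - e) ^ 2 = X ω ^ 2 - (2 * e) * X ω + e ^ 2 := fun ω => by ring
  simp only [h4] at h3
  have h5 : Integrable (fun ω => X ω ^ 2 - (2 * e) * X ω) P := h2.sub (h1.const_mul _)
  rw [integral_add h5 (integrable_const _), integral_sub h2 (h1.const_mul _), integral_const_mul,
    ← he] at h3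
  simp at h3
  linarith

/-- Jensen in ω and the decomposition around the mean. It converts the first moment occurring in the
recursion into √d_t. -/
lemma IsRun.sq_integral_norm_mean_sub_le (h : IsRun A K V α β F ν ξ θ) (hN : N ≠ 0)
    (hK : Feasible K R) (h0 : (0 : Vec M) ∈ shrink K V (β 1)) (hV : 0 ≤ V)
    (hF : ∀ i, Measurable fun p : K × S i => F i p.1 p.2) (hp : Perturbation P V ν)
    (hs : Sampling P D ν ξ) {t : ℕ} (ht : 1 ≤ t) {z : Vec M} (hz : z ∈ K) :
    N * (∫ ω, ‖(mean fun i => θ i t ω) - z‖ ∂P) ^ 2 ≤ meanSqDist P θ z t := by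
  have hθm := h.measurable hK.convex h0 hF hp hs ht
  have hm : Measurable fun ω => mean fun i => θ i t ω := measurable_mean hθm
  have hb : ∀ ω, ‖(mean fun i => θ i t ω) - z‖ ≤ 2 * R := fun ω =>
    hK.norm_sub_le (mean_mem hN hK.convex fun i => h.mem h0 hV ht i ω) hz
  have h1 := sq_integral_le_integral_sq (P := P) (hm.sub_const z).norm (B := 2 * R) fun ω => by
    rw [abs_of_nonneg (norm_nonneg _)]; exact hb ω
  calc _ ≤ N * ∫ ω, ‖(mean fun i => θ i t ω) - z‖ ^ 2 ∂P :=
        mul_le_mul_of_nonneg_left h1 (Nat.cast_nonneg N)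
    _ = ∫ ω, N * ‖(mean fun i => θ i t ω) - z‖ ^ 2 ∂P := (integral_const_mul _ _).symm
    _ ≤ _ := by
      refine integral_mono ((integrable_norm_sq hm hb).const_mul _)
        (integrable_finsetSum _ fun i _ => integrable_norm_sq (hθm i) fun ω =>
          hK.norm_sub_le (h.mem h0 hV ht i ω) hz) fun ω => ?_
      have h2 := sum_norm_sq_eq hN (fun i => θ i t ω) z
      have h3 : 0 ≤ ∑ i, ‖θ i t ω - mean fun i => θ i t ω‖ ^ 2 :=
        Finset.sum_nonneg fun i _ => by positivity
      simp only at h2 ⊢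
      linarith

/-- The recursion for the expected squared distance to the minimizer. -/
lemma IsRun.meanSqDist_succ_le (h : IsRun A K V α β F ν ξ θ) (hN : N ≠ 0) (hA : Network A a τ)
    (hK : Feasible K R) (h0 : (0 : Vec M) ∈ shrink K V (β 1)) (hV : 0 ≤ V)
    (hF : ∀ i, Measurable fun p : K × S i => F i p.1 p.2)
    (hFC : ∀ i, ∀ x ∈ K, ∀ s, |F i x s| ≤ C)
    (hp : Perturbation P V ν) (hs : Sampling P D ν ξ) {g : Fin N → Vec M → Vec M}
    (hg : ∀ i, ∀ x ∈ K, HasGradientWithinAt (localCost (F i) (D i)) (g i x) K x)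
    {Li : Fin N → ℝ} (hLi : ∀ i, 0 ≤ Li i)
    (hgL : ∀ i, ∀ x ∈ K, ∀ y ∈ K, ‖g i x - g i y‖ ≤ Li i * ‖x - y‖)
    {L μ : ℝ} (hμ : 0 ≤ μ) (hL : L = (∑ i, Li i) / N) {z : Vec M} (hz : z ∈ K)
    (hmono : ∀ x ∈ K, μ * ‖x - z‖ ^ 2 ≤ ⟪x - z, mean fun i => g i x⟫)
    {t : ℕ} (ht : 1 ≤ t) (hα : 0 ≤ α t) (hβ : 0 < β t) (hz' : z ∈ shrink K V (β (t + 1)))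
    {r e : ℝ} (hr : ∀ i ω, ‖θ i t ω - mean fun j => θ j t ω‖ ≤ r)
    (he : e = ∫ ω, ‖(mean fun i => θ i t ω) - z‖ ∂P) :
    meanSqDist P θ z (t + 1) ≤ meanSqDist P θ z t
      - 2 * α t * (μ * (meanSqDist P θ z t - N * r ^ 2) - N * L * r * e
        - N * L * (β t / 2 * (M * (√M * V))) * e)
      + N * ((√M * V * C * (α t / β t)) ^ 2 + 2 * r * (√M * V * C * (α t / β t))) := by
  have hN' : (N : ℝ) ≠ 0 := by exact_mod_cast hN
  have hθm := h.measurable hK.convex h0 hF hp hs ht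
  have hθm' := h.measurable hK.convex h0 hF hp hs (Nat.le_succ_of_le ht)
  have hmem := h.mem (θ := θ) h0 hV ht
  have hmm : ∀ ω, (mean fun i => θ i t ω) ∈ K := fun ω => mean_mem hN hK.convex fun i => hmem i ω
  have hm : Measurable fun ω => mean fun i => θ i t ω := measurable_mean hθm
  have hb : ∀ ω, ‖(mean fun i => θ i t ω) - z‖ ≤ 2 * R := fun ω => hK.norm_sub_le (hmm ω) hz
  set δ := √M * V * C * (α t / β t) with hδ
  set G : Fin N → Ω → Vec M := fun i ω =>
    gradEst (F i) (β t) (θ i t ω) (ν i t ω) (ξ i t ω) with hG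
  have hGm : ∀ i, Measurable (G i) := fun i =>
    measurable_gradEst (hF i) (hθm i) (hp.measurable i t) (hs.measurable i t) fun ω =>
      h.mem_shrink h0 ht i ω _ (hp.abs_le i t ht ω)
  have hGb : ∀ i ω, ‖G i ω‖ ≤ √M * V * C / β t := fun i ω =>
    norm_gradEst_le (hFC i) hV hβ (h.mem_shrink h0 ht i ω) (hp.abs_le i t ht ω)
  have hgc : ∀ i, ContinuousOn (g i) K := fun i => by
    refine LipschitzOnWith.continuousOn (K := (Li i).toNNReal) (LipschitzOnWith.of_dist_le_mul ?_)
    intro x hx y hy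
    rw [dist_eq_norm, dist_eq_norm, Real.coe_toNNReal _ (hLi i)]
    exact hgL i x hx y hy
  have hgm : ∀ i, Measurable fun ω => g i (θ i t ω) := fun i =>
    measurable_comp_of_continuousOn (hgc i) (hθm i) (hmem i)
  have hgb : ∀ i ω, ‖g i (θ i t ω)‖ ≤ ‖g i 0‖ + Li i * R := fun i ω => by
    have h1 := hgL i _ (hmem i ω) 0 hK.zero_mem
    rw [sub_zero] at h1
    have h2 := mul_le_mul_of_nonneg_left (hK.norm_le _ (hmem i ω)) (hLi i)
    have h3 := norm_le_norm_add_norm_sub' (g i (θ i t ω)) (g i 0)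
    linarith
  have hinner : ∀ {u : Ω → Vec M} {B : ℝ}, Measurable u → (∀ ω, ‖u ω‖ ≤ B) →
      Integrable (fun ω => ⟪(mean fun i => θ i t ω) - z, u ω⟫) P := fun {u B} hu huB => by
    refine integrable_of_bounded ((hm.sub_const z).inner hu) (B := 2 * R * B) fun ω => ?_
    exact (abs_real_inner_le_norm _ _).trans (mul_le_mul (hb ω) (huB ω) (norm_nonneg _)
      ((norm_nonneg _).trans (hb ω)))
  have iD : Integrable (fun ω => ∑ i, ‖θ i t ω - z‖ ^ 2) P :=
    integrable_finsetSum _ fun i _ => integrable_norm_sq (hθm i) fun ω =>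
      hK.norm_sub_le (hmem i ω) hz
  have iD' : Integrable (fun ω => ∑ i, ‖θ i (t + 1) ω - z‖ ^ 2) P :=
    integrable_finsetSum _ fun i _ => integrable_norm_sq (hθm' i) fun ω =>
      hK.norm_sub_le (h.mem h0 hV (Nat.le_succ_of_le ht) i ω) hz
  have iG : Integrable (fun ω => ∑ i, ⟪(mean fun i => θ i t ω) - z, G i ω⟫) P :=
    integrable_finsetSum _ fun i _ => hinner (hGm i) (hGb i)
  have ig : Integrable (fun ω => ∑ i, ⟪(mean fun i => θ i t ω) - z, g i (θ i t ω)⟫) P :=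
    integrable_finsetSum _ fun i _ => hinner (hgm i) (hgb i)
  have im : Integrable (fun ω => ‖(mean fun i => θ i t ω) - z‖) P :=
    integrable_of_bounded (hm.sub_const z).norm (B := 2 * R) fun ω => by
      rw [abs_of_nonneg (norm_nonneg _)]; exact hb ω
  -- the descent step
  have s1 : meanSqDist P θ z (t + 1) ≤ meanSqDist P θ z t
      - 2 * α t * ∫ ω, ∑ i, ⟪(mean fun i => θ i t ω) - z, G i ω⟫ ∂P
      + N * (δ ^ 2 + 2 * r * δ) := by
    have i1 : Integrable (fun ω => ∑ i, ‖θ i t ω - z‖ ^ 2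
        - 2 * α t * ∑ i, ⟪(mean fun i => θ i t ω) - z, G i ω⟫) P := iD.sub (iG.const_mul _)
    have i2 : Integrable (fun _ : Ω => (N : ℝ) * (δ ^ 2 + 2 * r * δ)) P := integrable_const _
    have := integral_mono iD' (i1.add i2) fun ω =>
      sum_norm_sq_step_le (hA.doublyStochastic t) (x := fun i => θ i t ω)
        (x' := fun i => θ i (t + 1) ω) (g := fun i => G i ω) (z := z) (fun i => hr i ω)
        (fun i => h.norm_smul_gradEst_le h0 hV hFC hp.abs_le ht hα hβ i ω)
        (fun i => (h.step i t ht ω).norm_sub_le (shrink_convex hK.convex _) hz')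
    simp only [Pi.add_apply] at this
    rw [integral_add i1 i2, integral_sub iD (iG.const_mul _), integral_const_mul] at this
    simpa [meanSqDist] using this
  -- the gradient estimates
  have s2 : ∫ ω, ∑ i, ⟪(mean fun i => θ i t ω) - z, g i (θ i t ω)⟫ ∂P
      - N * L * (β t / 2 * (M * (√M * V))) * e
      ≤ ∫ ω, ∑ i, ⟪(mean fun i => θ i t ω) - z, G i ω⟫ ∂P := by
    rw [integral_finsetSum _ fun i _ => hinner (hGm i) (hGb i),
      integral_finsetSum _ fun i _ => hinner (hgm i) (hgb i)]
    have h1 := Finset.sum_le_sum fun i (_ : i ∈ Finset.univ) =>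
      h.integral_inner_gradEst_ge hK h0 hV hF hFC hp hs hg hLi hgL ht hβ hb i
    rw [Finset.sum_sub_distrib, ← he] at h1
    refine le_trans (le_of_eq ?_) h1
    congr 1
    have h6 : ∑ i, Li i = N * L := by rw [hL]; field_simp
    rw [← h6, Finset.sum_mul, Finset.sum_mul]
    exact Finset.sum_congr rfl fun i _ => by ring
  -- strong monotonicity
  have s3 : μ * (meanSqDist P θ z t - N * r ^ 2) - N * L * r * e
      ≤ ∫ ω, ∑ i, ⟪(mean fun i => θ i t ω) - z, g i (θ i t ω)⟫ ∂P := by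
    have i2 : Integrable (fun _ : Ω => (N : ℝ) * r ^ 2) P := integrable_const _
    have i1 : Integrable (fun ω => μ * (∑ i, ‖θ i t ω - z‖ ^ 2 - N * r ^ 2)) P :=
      (iD.sub i2).const_mul _
    have i3 := im.const_mul (N * L * r)
    have := integral_mono (i1.sub i3) ig fun ω =>
      sum_inner_gradient_ge hN hμ hLi hL hgL hmono (x := fun i => θ i t ω) (fun i => hmem i ω)
        (hmm ω) (fun i => hr i ω)
    simp only [Pi.sub_apply] at this
    rw [integral_sub i1 i3, integral_const_mul, integral_const_mul, integral_sub iD i2, ← he]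
      at this
    simpa [meanSqDist] using this
  have s4 := mul_le_mul_of_nonneg_left (add_le_add s2 s3) (by positivity : 0 ≤ 2 * α t)
  linarith

end Recursion

/-! ### The decay envelope -/

/-- The envelope `w² (t^{-1/4} + x t^{-3/4})²` of the expected squared distance. -/
def envelope (w x : ℝ) (t : ℕ) : ℝ :=
  w ^ 2 / √t * (1 + x / √t) ^ 2

/-- Here q = √t and q' = √(t + 1). The contraction 6/t beats the decay of the envelope by enough to
absorb the three error terms. -/
lemma envelope_step {w x q q' : ℝ} (hx : 0 ≤ x) (hq : 1 ≤ q) (hq' : 0 < q')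
    (h : q' ^ 2 = q ^ 2 + 1) :
    (1 - 6 / q ^ 2) * (w ^ 2 / q * (1 + x / q) ^ 2)
      + (3 * w ^ 2 / q ^ 3 + 9 / 2 * x * w ^ 2 / q ^ 4) * (1 + x / q) + 3 / 4 * w ^ 2 / q ^ 3
      ≤ w ^ 2 / q' * (1 + x / q') ^ 2 := by
  have hq0 : 0 < q := by linarith
  set z := x / q with hz
  set ε := 1 / q ^ 2 with hε
  set r := q / q' with hr
  have hz0 : 0 ≤ z := by positivity
  have hε0 : 0 < ε := by positivity
  have hε1 : ε ≤ 1 := by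
    rw [hε, div_le_one (by positivity)]; nlinarith
  have hr0 : 0 < r := by positivity
  have hr2 : r ^ 2 * (1 + ε) = 1 := by
    rw [hr, hε, div_pow, h]; field_simp
  have h2 : 1 - ε ≤ r ^ 2 := by nlinarith [sq_nonneg r, mul_pos hε0 hε0]
  have h1 : 1 - ε / 2 ≤ r := by
    apply le_of_sq_le_sq _ hr0.le
    have : (1 - ε / 2) ^ 2 * (1 + ε) ≤ r ^ 2 * (1 + ε) := by
      rw [hr2]; nlinarith [mul_pos hε0 hε0, mul_nonneg (mul_pos hε0 hε0).le (sub_nonneg.2 hε1)]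
    exact le_of_mul_le_mul_right this (by linarith)
  have h3 : 1 - 3 / 2 * ε ≤ r ^ 3 := by
    have : (1 - ε / 2) * (1 - ε) ≤ r * r ^ 2 :=
      mul_le_mul h1 h2 (by linarith) hr0.le
    nlinarith [mul_pos hε0 hε0]
  -- After division by w²/q, compare powers of z with the bounds on r, r², r³: 1 − 9ε/4 ≤ 1 − ε/2, 2
  -- − 9ε/2 ≤ 2 − 2ε, and for z² both sides are 1 − 3ε/2.
  have key : (1 - 6 * ε) * (1 + z) ^ 2 + ε * (3 + 9 / 2 * z) * (1 + z) + 3 / 4 * ε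
      ≤ r * (1 + z * r) ^ 2 := by
    have e1 : r * (1 + z * r) ^ 2 = r + 2 * z * r ^ 2 + z ^ 2 * r ^ 3 := by ring
    rw [e1]
    have a2 := mul_le_mul_of_nonneg_left h2 (by positivity : 0 ≤ 2 * z)
    have a3 := mul_le_mul_of_nonneg_left h3 (sq_nonneg z)
    nlinarith [mul_nonneg hε0.le hz0]
  have hw : 0 ≤ w ^ 2 / q := by positivity
  have := mul_le_mul_of_nonneg_left key hw
  have eL : (1 - 6 / q ^ 2) * (w ^ 2 / q * (1 + z) ^ 2)
      + (3 * w ^ 2 / q ^ 3 + 9 / 2 * x * w ^ 2 / q ^ 4) * (1 + z) + 3 / 4 * w ^ 2 / q ^ 3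
      = w ^ 2 / q * ((1 - 6 * ε) * (1 + z) ^ 2 + ε * (3 + 9 / 2 * z) * (1 + z) + 3 / 4 * ε) := by
    rw [hz, hε]; field_simp
  have eR : w ^ 2 / q' * (1 + x / q') ^ 2 = w ^ 2 / q * (r * (1 + z * r) ^ 2) := by
    rw [hz, hr]; field_simp
  rw [eL, eR]
  exact this

/-- The relation b⁴l₁² = 6l₃ expresses the variance term through c = l₁b/μ, and l₂ = xμb²l₁ does the
same for the disagreement term. All errors are then multiples of c, and c ≤ w is all that is asked
of the amplitude. -/
lemma envelope_step_of_recursion {l₁ l₂ l₃ μ b w x p q q' d d' α β : ℝ} (hl₁ : 0 < l₁) (hμ : 0 < μ)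
    (hb : 0 < b) (hw : 0 ≤ w) (hx : 0 ≤ x) (hp : 0 < p) (hpq : p ^ 2 * q = 1) (hq : 6 ≤ q ^ 2)
    (hq0 : 0 < q) (hq' : 0 < q') (hqq' : q' ^ 2 = q ^ 2 + 1) (hb4 : b ^ 4 * l₁ ^ 2 = 6 * l₃)
    (hl₂ : l₂ = x * μ * b ^ 2 * l₁) (hbw : l₁ * b ≤ w * μ) (hα : α = 3 / μ / q ^ 2)
    (hβ : β = b * p) (hd : d ≤ w ^ 2 / q * (1 + x / q) ^ 2)
    (hd' : d' ≤ (1 - 2 * α * μ) * d + (α * β * l₁ + l₂ / 2 * (α ^ 2 / β)) * √d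
      + l₃ / 2 * (α / β) ^ 2) :
    d' ≤ w ^ 2 / q' * (1 + x / q') ^ 2 := by
  have hq1 : 1 ≤ q := by nlinarith
  refine le_trans ?_ (envelope_step hx hq1 hq' hqq')
  have hsq : √d ≤ w * p * (1 + x / q) := by
    refine Real.sqrt_le_iff.2 ⟨by positivity, hd.trans_eq ?_⟩
    rw [mul_pow, mul_pow, eq_one_div_of_mul_eq_one_left hpq]; ring
  have hαμ : 2 * α * μ = 6 / q ^ 2 := by rw [hα]; field_simp; norm_num
  have hp2 : p ^ 2 = 1 / q := eq_one_div_of_mul_eq_one_left hpq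
  set c := l₁ * b / μ with hc
  have hcw : c ≤ w := by rw [hc, div_le_iff₀ hμ]; exact hbw
  have hc0 : 0 < c := by positivity
  have e1 : α * β * l₁ * p = 3 * c / q ^ 3 := by
    have : α * β * l₁ * p = α * b * l₁ * p ^ 2 := by rw [hβ]; ring
    rw [this, hp2, hα, hc]; field_simp
  have e2 : l₂ / 2 * (α ^ 2 / β) * p = 9 / 2 * x * c / q ^ 4 := by
    rw [hl₂, hα, hβ, hc]; field_simp; ring
  have e3 : l₃ / 2 * (α / β) ^ 2 = 3 / 4 * c ^ 2 / q ^ 3 := by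
    have : l₃ = b ^ 4 * l₁ ^ 2 / 6 := by linarith
    rw [this, hα, hβ, hc, div_pow, mul_pow, hp2]; field_simp; norm_num
  have hcoef : 0 ≤ α * β * l₁ + l₂ / 2 * (α ^ 2 / β) := by
    rw [hl₂, hα, hβ]; positivity
  have t1 : (1 - 2 * α * μ) * d ≤ (1 - 6 / q ^ 2) * (w ^ 2 / q * (1 + x / q) ^ 2) := by
    rw [hαμ]
    refine mul_le_mul_of_nonneg_left hd ?_
    rw [sub_nonneg, div_le_one (by positivity)]; exact hq
  have t2 : (α * β * l₁ + l₂ / 2 * (α ^ 2 / β)) * √d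
      ≤ (3 * w ^ 2 / q ^ 3 + 9 / 2 * x * w ^ 2 / q ^ 4) * (1 + x / q) := by
    refine (mul_le_mul_of_nonneg_left hsq hcoef).trans ?_
    have : (α * β * l₁ + l₂ / 2 * (α ^ 2 / β)) * (w * p * (1 + x / q))
        = (3 * (c * w) / q ^ 3 + 9 / 2 * x * (c * w) / q ^ 4) * (1 + x / q) := by
      calc _ = (α * β * l₁ * p + l₂ / 2 * (α ^ 2 / β) * p) * w * (1 + x / q) := by ring
        _ = _ := by rw [e1, e2]; ring
    rw [this]
    have hcw2 : c * w ≤ w ^ 2 := by nlinarith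
    gcongr
  have t3 : l₃ / 2 * (α / β) ^ 2 ≤ 3 / 4 * w ^ 2 / q ^ 3 := by
    rw [e3]; gcongr
  linarith

lemma sum_inv_sqrt_le (T : ℕ) : ∑ t ∈ Finset.Icc 1 T, 1 / √(t : ℝ) ≤ 2 * √T := by
  induction T with
  | zero => simp
  | succ T ih =>
    rw [Finset.sum_Icc_succ_top (by omega)]
    have h0 : 0 ≤ √(T : ℝ) := Real.sqrt_nonneg _
    have h1 : 0 < √((T + 1 : ℕ) : ℝ) := Real.sqrt_pos.2 (by positivity)
    have h2 : √(T : ℝ) ^ 2 = T := Real.sq_sqrt (by positivity)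
    have h3 : √((T + 1 : ℕ) : ℝ) ^ 2 = T + 1 := by rw [Real.sq_sqrt (by positivity)]; push_cast; ring
    set p := √(T : ℝ)
    set q := √((T + 1 : ℕ) : ℝ)
    have : 1 / q ≤ 2 * q - 2 * p := by
      rw [div_le_iff₀ h1]; nlinarith [sq_nonneg (q - p)]
    linarith

/-- Each new term is at most the increment of −2/√T, so the sum telescopes; equality holds at T = 1.
-/
lemma sum_inv_sqrt_cube_le (T : ℕ) (hT : 1 ≤ T) :
    ∑ t ∈ Finset.Icc 1 T, 1 / √(t : ℝ) ^ 3 ≤ 3 - 2 / √T := by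
  induction T, hT using Nat.le_induction with
  | base => norm_num
  | succ T hT ih =>
    rw [Finset.sum_Icc_succ_top (by omega)]
    have hT' : (1 : ℝ) ≤ T := by exact_mod_cast hT
    have h0 : 0 < √(T : ℝ) := Real.sqrt_pos.2 (by linarith)
    have h1 : 0 < √((T + 1 : ℕ) : ℝ) := Real.sqrt_pos.2 (by positivity)
    have h2 : √(T : ℝ) ^ 2 = T := Real.sq_sqrt (by positivity)
    have h3 : √((T + 1 : ℕ) : ℝ) ^ 2 = T + 1 := by rw [Real.sq_sqrt (by positivity)]; push_cast; ring
    have h4 : √(T : ℝ) ≤ √((T + 1 : ℕ) : ℝ) := Real.sqrt_le_sqrt (by push_cast; linarith)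
    set p := √(T : ℝ)
    set q := √((T + 1 : ℕ) : ℝ)
    have : 1 / q ^ 3 ≤ 2 / p - 2 / q := by
      have e : 2 / p - 2 / q - 1 / q ^ 3 = (2 * q ^ 2 * (q - p) - p) / (p * q ^ 3) := by
        field_simp
      have h5 : (q - p) * (q + p) = 1 := by linarith [sq_sub_sq q p]
      have h6 : 0 ≤ 2 * q ^ 2 * (q - p) - p := by
        have h7 : 0 ≤ q - p := by linarith
        nlinarith [mul_nonneg h7 (mul_nonneg h1.le (sub_nonneg.2 h4)), mul_pos h0 h1]
      have : 0 ≤ (2 * q ^ 2 * (q - p) - p) / (p * q ^ 3) := by positivity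
      linarith
    linarith

lemma sum_inv_le (T : ℕ) : ∑ t ∈ Finset.Icc 1 T, 1 / (t : ℝ) ≤ 1 + Real.log T := by
  have := harmonic_le_one_add_log T
  rw [harmonic_eq_sum_Icc] at this
  push_cast at this
  simpa using this

lemma sum_envelope_le {w x : ℝ} (hx : 0 ≤ x) {T : ℕ} (hT : 1 ≤ T) :
    ∑ t ∈ Finset.Icc 1 T, envelope w x t
      ≤ w ^ 2 * (2 * √T + 2 * x * (1 + Real.log T) + 3 * x ^ 2) := by
  have h1 : ∀ t ∈ Finset.Icc 1 T, envelope w x t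
      = w ^ 2 * (1 / √(t : ℝ) + 2 * x * (1 / (t : ℝ)) + x ^ 2 * (1 / √(t : ℝ) ^ 3)) := by
    intro t ht
    have ht' : (0 : ℝ) < t := by exact_mod_cast (Finset.mem_Icc.1 ht).1
    have h2 : √(t : ℝ) ^ 2 = t := Real.sq_sqrt ht'.le
    have h3 : 0 < √(t : ℝ) := Real.sqrt_pos.2 ht'
    rw [envelope]
    nth_rewrite 4 [← h2]
    field_simp
    ring
  rw [Finset.sum_congr rfl h1, ← Finset.mul_sum, Finset.sum_add_distrib, Finset.sum_add_distrib,
    ← Finset.mul_sum, ← Finset.mul_sum]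
  refine mul_le_mul_of_nonneg_left ?_ (sq_nonneg w)
  have a1 := sum_inv_sqrt_le T
  have a2 := mul_le_mul_of_nonneg_left (sum_inv_le T) (by positivity : 0 ≤ 2 * x)
  have a3 := mul_le_mul_of_nonneg_left (sum_inv_sqrt_cube_le T hT) (sq_nonneg x)
  have a4 : 0 ≤ 2 / √(T : ℝ) := by positivity
  nlinarith [mul_nonneg (sq_nonneg x) a4]

/-! ### The constants of the algorithm -/

section AlgorithmConstants

variable {N M τ : ℕ} {a V C L μ R : ℝ}

lemma mul_rho_le_kappa (hN : 2 ≤ N) (hτ : 1 ≤ τ) (ha : 0 < a) (ha' : a ≤ 1 / 2) :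
    N * (rho N τ a / 2) * ((7 - 4 * eta N τ a) / (4 * (1 - eta N τ a) ^ 2))
      ≤ kappa N τ a / 2 := by
  have h1 := eta_lt_one hN hτ ha ha'
  have h2 := one_le_rho_half hN hτ ha ha'
  have h3 : (7 - 4 * eta N τ a) / (4 * (1 - eta N τ a) ^ 2)
      ≤ (10 - 7 * eta N τ a) / (4 * (1 - eta N τ a) ^ 2) :=
    div_le_div_of_nonneg_right (by linarith) (by positivity)
  have h4 : 0 ≤ N * (rho N τ a / 2) := by positivity
  have h5 : (0 : ℝ) < 2 ^ (7 / 4 : ℝ) := by positivity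
  have := mul_le_mul_of_nonneg_left h3 h4
  rw [kappa]
  linarith

/-- The summand 2^{7/4} alone suffices. A lower bound on κ is what absorbs the cross term between
disagreement and step size. -/
lemma two_le_kappa (hN : 2 ≤ N) (hτ : 1 ≤ τ) (ha : 0 < a) (ha' : a ≤ 1 / 2) :
    2 ≤ kappa N τ a := by
  have h1 := eta_lt_one hN hτ ha ha'
  have h2 := one_le_rho_half hN hτ ha ha'
  have h3 : (2 : ℝ) ^ (1 : ℝ) ≤ 2 ^ (7 / 4 : ℝ) :=
    Real.rpow_le_rpow_of_exponent_le (by norm_num) (by norm_num)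
  rw [Real.rpow_one] at h3
  have h4 : 0 ≤ (10 - 7 * eta N τ a) / (4 * (1 - eta N τ a) ^ 2) :=
    div_nonneg (by linarith) (by positivity)
  have h5 : 0 ≤ N * rho N τ a := mul_nonneg (by positivity) (by linarith)
  rw [kappa]
  linarith [mul_nonneg h5 h4]

lemma lamI_pos (hN : 2 ≤ N) (hM : 1 ≤ M) (hV : 1 ≤ V) (hL : 0 < L) : 0 < lamI N M V L := by
  have : (0 : ℝ) < N := by exact_mod_cast (by omega : 0 < N)
  have : (0 : ℝ) < M := by exact_mod_cast hM
  have : 0 < V := by linarith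
  unfold lamI; positivity

lemma lamII_nonneg (hN : 2 ≤ N) (hτ : 1 ≤ τ) (ha : 0 < a) (ha' : a ≤ 1 / 2)
    (hV : 1 ≤ V) (hL : 0 < L) (hC : 0 < C) : 0 ≤ lamII N M τ a V C L := by
  have : 0 ≤ kappa N τ a := by linarith [two_le_kappa hN hτ ha ha']
  have : 0 < V := by linarith
  unfold lamII; positivity

lemma lamIII_pos (hN : 2 ≤ N) (hM : 1 ≤ M) (hV : 1 ≤ V) (hC : 0 < C) :
    0 < lamIII N M τ a V C := by
  have : (0 : ℝ) < N := by exact_mod_cast (by omega : 0 < N)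
  have : (0 : ℝ) < M := by exact_mod_cast hM
  have : 0 < V := by linarith
  unfold lamIII; positivity

lemma beta0_pos (hN : 2 ≤ N) (hM : 1 ≤ M) (hV : 1 ≤ V) (hL : 0 < L) (hC : 0 < C) :
    0 < beta0 N M τ a V C L := by
  have h1 := lamI_pos hN hM hV hL
  have h2 := lamIII_pos (τ := τ) (a := a) hN hM hV hC
  unfold beta0; positivity

lemma beta0_pow_four (hN : 2 ≤ N) (hM : 1 ≤ M) (hV : 1 ≤ V) (hL : 0 < L) (hC : 0 < C) :
    beta0 N M τ a V C L ^ 4 * lamI N M V L ^ 2 = 6 * lamIII N M τ a V C := by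
  have h1 := lamI_pos hN hM hV hL
  have h2 := lamIII_pos (τ := τ) (a := a) hN hM hV hC
  have h3 : beta0 N M τ a V C L ^ 4 = 6 * (lamI N M V L ^ 2)⁻¹ * lamIII N M τ a V C := by
    have := Real.rpow_inv_natCast_pow (x := 6 * (lamI N M V L ^ 2)⁻¹ * lamIII N M τ a V C)
      (n := 4) (by positivity) (by norm_num)
    rw [← this, beta0]; norm_num
  rw [h3]; field_simp

lemma beta0_sq_mul (hN : 2 ≤ N) (hM : 1 ≤ M) (hV : 1 ≤ V) (hL : 0 < L) (hC : 0 < C) :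
    beta0 N M τ a V C L ^ 2 * lamI N M V L = √(6 * lamIII N M τ a V C) := by
  rw [← beta0_pow_four hN hM hV hL hC]
  have h1 := lamI_pos hN hM hV hL
  symm
  rw [Real.sqrt_eq_iff_mul_self_eq (by positivity) (by positivity)]
  ring

lemma beta_one : beta N M τ a V C L 1 = beta0 N M τ a V C L := by simp [beta]

lemma beta_pos (h : 0 < beta0 N M τ a V C L) {t : ℕ} (ht : 1 ≤ t) : 0 < beta N M τ a V C L t := by
  have : (0 : ℝ) < t := by exact_mod_cast ht
  unfold beta; positivity

lemma beta_anti (h : 0 < beta0 N M τ a V C L) {s t : ℕ} (hs : 1 ≤ s) (hst : s ≤ t) :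
    beta N M τ a V C L t ≤ beta N M τ a V C L s := by
  have hs' : (0 : ℝ) < s := by exact_mod_cast hs
  refine mul_le_mul_of_nonneg_left ?_ h.le
  exact Real.rpow_le_rpow_of_nonpos hs' (by exact_mod_cast hst) (by norm_num)

lemma alpha_pos (hμ : 0 < μ) {t : ℕ} (ht : 1 ≤ t) : 0 < alpha μ t := by
  have : (0 : ℝ) < t := by exact_mod_cast ht
  unfold alpha; positivity

lemma alpha_div_beta (h : 0 < beta0 N M τ a V C L) (hμ : 0 < μ) {t : ℕ} (ht : 1 ≤ t) :
    alpha μ t / beta N M τ a V C L t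
      = 3 / (μ * beta0 N M τ a V C L) * (t : ℝ) ^ (-(3 / 4) : ℝ) := by
  have ht' : (0 : ℝ) < t := by exact_mod_cast ht
  have h1 : (t : ℝ)⁻¹ = (t : ℝ) ^ (-(3 / 4) : ℝ) * (t : ℝ) ^ (-(1 / 4) : ℝ) := by
    rw [← Real.rpow_add ht', ← Real.rpow_neg_one]; norm_num
  have h2 : 0 < (t : ℝ) ^ (-(1 / 4) : ℝ) := by positivity
  rw [alpha, beta, h1]
  field_simp

lemma lamI_eq (V L : ℝ) : lamI N M V L = √N * (M * √M) * V ^ 2 * L := by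
  rw [lamI, Real.sqrt_mul (by positivity)]
  congr 3
  have : (M : ℝ) ^ 3 = M ^ 2 * M := by ring
  rw [this, Real.sqrt_mul (by positivity), Real.sqrt_sq (by positivity)]

lemma lamII_eq : lamII N M τ a V C L = 2 * L * (√N * √M) * V * C * kappa N τ a := by
  rw [lamII, Real.sqrt_mul (by positivity)]

/-- The recursion for the expected squared distance in terms of the constants of the theorem. -/
lemma recursion_constants {d d' e α β δ r : ℝ} (hN : 2 ≤ N) (hV : 1 ≤ V)
    (hL : 0 < L) (hC : 0 < C) (hκ : 2 ≤ kappa N τ a) (hα : 0 < α) (hβ : 0 < β)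
    (hαμ : 2 * α * μ ≤ 1) (he : N * e ^ 2 ≤ d)
    (hδ : δ = √M * V * C * (α / β)) (hr : r = kappa N τ a / 2 * δ)
    (h : d' ≤ d - 2 * α * (μ * (d - N * r ^ 2) - N * L * r * e
        - N * L * (β / 2 * (M * (√M * V))) * e) + N * (δ ^ 2 + 2 * r * δ)) :
    d' ≤ (1 - 2 * α * μ) * d + (α * β * lamI N M V L
      + lamII N M τ a V C L / 2 * (α ^ 2 / β)) * √d + lamIII N M τ a V C / 2 * (α / β) ^ 2 := by
  have hN0 : (0 : ℝ) < N := by exact_mod_cast (by omega : 0 < N)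
  have hV0 : 0 < V := by linarith
  set κ := kappa N τ a with hκd
  have hsN : √(N : ℝ) ^ 2 = N := Real.sq_sqrt hN0.le
  have hsM : √(M : ℝ) ^ 2 = M := Real.sq_sqrt (Nat.cast_nonneg M)
  have hsN0 : 0 < √(N : ℝ) := Real.sqrt_pos.2 hN0
  have hse : √(N : ℝ) * e ≤ √d := by
    apply Real.le_sqrt_of_sq_le
    rw [mul_pow, hsN]; exact he
  have hsd : 0 ≤ √d := Real.sqrt_nonneg d
  have t1 : 2 * α * (N * L * r * e) ≤ lamII N M τ a V C L / 2 * (α ^ 2 / β) * √d := by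
    have e1 : 2 * α * (N * L * r * e)
        = lamII N M τ a V C L / 2 * (α ^ 2 / β) * (√(N : ℝ) * e) := by
      rw [lamII_eq, hr, hδ]; nth_rewrite 1 [← hsN]; rw [← hκd]; field_simp
    rw [e1, lamII_eq, ← hκd]
    exact mul_le_mul_of_nonneg_left hse (by positivity)
  have t2 : 2 * α * (N * L * (β / 2 * (M * (√M * V))) * e) ≤ α * β * lamI N M V L * √d := by
    have e1 : 2 * α * (N * L * (β / 2 * (M * (√M * V))) * e)
        = α * β * (√N * (M * √M) * V * L) * (√(N : ℝ) * e) := by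
      nth_rewrite 1 [← hsN]; ring
    rw [e1, lamI_eq]
    refine (mul_le_mul_of_nonneg_left hse (by positivity)).trans
      (mul_le_mul_of_nonneg_right ?_ hsd)
    -- The bias is only linear in V; λ_I carries V², and V ≥ 1.
    have : V ≤ V ^ 2 := by nlinarith
    gcongr
  have t3 : 2 * α * μ * (N * r ^ 2) ≤ N * r ^ 2 :=
    mul_le_of_le_one_left (by positivity) hαμ
  have t4 : N * r ^ 2 + N * (δ ^ 2 + 2 * r * δ) ≤ lamIII N M τ a V C / 2 * (α / β) ^ 2 := by
    have e1 : lamIII N M τ a V C / 2 * (α / β) ^ 2 = N * δ ^ 2 * (κ ^ 2 + 1) := by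
      rw [lamIII, hδ, ← hκd, mul_pow, mul_pow, mul_pow, hsM]; ring
    have e2 : N * r ^ 2 + N * (δ ^ 2 + 2 * r * δ) = N * δ ^ 2 * (κ ^ 2 / 4 + 1 + κ) := by
      rw [hr]; ring
    rw [e1, e2]
    refine mul_le_mul_of_nonneg_left ?_ (by positivity)
    -- The inequality amounts to κ ≤ 3κ²/4, which follows from κ ≥ 2.
    nlinarith
  linarith

/-- The ratio `λ_II / (μ √(6 λ_III))`. -/
def ratio (N M τ : ℕ) (a V C L μ : ℝ) : ℝ :=
  lamII N M τ a V C L / (μ * √(6 * lamIII N M τ a V C))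

/-- The amplitude `√Ψ* λ_I` of the envelope. -/
def amplitude (N M τ : ℕ) (a V C L μ R : ℝ) : ℝ :=
  √(PsiStar N M τ a V C L μ R) * lamI N M V L

lemma PsiStar_nonneg (hV : 1 ≤ V) (hL : 0 < L) : 0 ≤ PsiStar N M τ a V C L μ R := by
  have : 0 < V := by linarith
  refine le_max_of_le_right ?_
  unfold lamI; positivity

lemma amplitude_sq (hV : 1 ≤ V) (hL : 0 < L) :
    amplitude N M τ a V C L μ R ^ 2 = PsiStar N M τ a V C L μ R * lamI N M V L ^ 2 := by
  rw [amplitude, mul_pow, Real.sq_sqrt (PsiStar_nonneg hV hL)]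

/-- The second argument of the maximum in Ψ* equals (β₀/μ)². -/
lemma lamI_mul_beta0_le (hN : 2 ≤ N) (hM : 1 ≤ M) (hV : 1 ≤ V) (hL : 0 < L) (hC : 0 < C)
    (hμ : 0 < μ) :
    lamI N M V L * beta0 N M τ a V C L ≤ amplitude N M τ a V C L μ R * μ := by
  have h1 := lamI_pos hN hM hV hL
  have h0 := beta0_pos (τ := τ) (a := a) hN hM hV hL hC
  have h2 : (beta0 N M τ a V C L / μ) ^ 2 ≤ PsiStar N M τ a V C L μ R := by
    refine le_trans (le_of_eq ?_) (le_max_right _ _)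
    rw [← beta0_sq_mul hN hM hV hL hC]; field_simp
  have h3 := Real.le_sqrt_of_sq_le h2
  rw [div_le_iff₀ hμ] at h3
  rw [amplitude]
  calc _ ≤ lamI N M V L * (√(PsiStar N M τ a V C L μ R) * μ) :=
        mul_le_mul_of_nonneg_left h3 h1.le
    _ = _ := by ring

lemma lamII_eq_ratio (hN : 2 ≤ N) (hM : 1 ≤ M) (hV : 1 ≤ V) (hL : 0 < L) (hC : 0 < C)
    (hμ : 0 < μ) : lamII N M τ a V C L
      = ratio N M τ a V C L μ * μ * beta0 N M τ a V C L ^ 2 * lamI N M V L := by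
  have h2 := lamIII_pos (τ := τ) (a := a) hN hM hV hC
  have : 0 < √(6 * lamIII N M τ a V C) := by positivity
  rw [mul_assoc, beta0_sq_mul hN hM hV hL hC, ratio]
  field_simp

/-- During the first six steps the diameter bound lies below the envelope. -/
lemma diameter_le_envelope (hN : 2 ≤ N) (hM : 1 ≤ M) (hτ : 1 ≤ τ) (ha : 0 < a) (ha' : a ≤ 1 / 2)
    (hV : 1 ≤ V) (hL : 0 < L) (hC : 0 < C) (hμ : 0 < μ) {t : ℕ} (ht : 1 ≤ t) (ht6 : t ≤ 6) :
    4 * N * R ^ 2 ≤ envelope (amplitude N M τ a V C L μ R) (ratio N M τ a V C L μ) t := by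
  have h1 := lamI_pos hN hM hV hL
  have h2 := lamIII_pos (τ := τ) (a := a) hN hM hV hC
  have h3 : 0 ≤ lamII N M τ a V C L := lamII_nonneg hN hτ ha ha' hV hL hC
  have ht0 : (0 : ℝ) < t := by exact_mod_cast ht
  have hs0 : 0 < √(t : ℝ) := Real.sqrt_pos.2 ht0
  have hs6 : √(t : ℝ) ≤ √6 := Real.sqrt_le_sqrt (by exact_mod_cast ht6)
  have hx0 : 0 ≤ ratio N M τ a V C L μ := by unfold ratio; positivity
  have h66 : √6 * √6 = (6 : ℝ) := Real.mul_self_sqrt (by norm_num)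
  set x := ratio N M τ a V C L μ with hx
  have e1 : lamI N M V L * lamII N M τ a V C L / (6 * μ * √(lamIII N M τ a V C))
      = lamI N M V L * (x / √6) := by
    have h4 : 0 < √(lamIII N M τ a V C) := by positivity
    rw [hx, ratio, Real.sqrt_mul (by norm_num)]
    nth_rewrite 1 [← h66]
    field_simp
  -- The first argument of the maximum is the value of w²/λ_I² for which the envelope at t = 6
  -- equals 4NR²; the envelope is larger at earlier times.
  have h5 : 4 * √6 * N * R ^ 2 * ((lamI N M V L * (1 + x / √6)) ^ 2)⁻¹
      ≤ PsiStar N M τ a V C L μ R := by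
    refine le_trans (le_of_eq ?_) (le_max_left _ _)
    rw [e1]; congr 3; ring
  have h6 : 4 * √6 * N * R ^ 2 / (1 + x / √6) ^ 2 ≤ amplitude N M τ a V C L μ R ^ 2 := by
    rw [amplitude_sq hV hL]
    refine le_trans (le_of_eq ?_) (mul_le_mul_of_nonneg_right h5 (sq_nonneg _))
    field_simp
  have h7 : x / √6 ≤ x / √(t : ℝ) := div_le_div_of_nonneg_left hx0 hs0 hs6
  have h8 : 0 < 1 + x / √6 := by positivity
  rw [envelope]
  calc 4 * N * R ^ 2 = 4 * √6 * N * R ^ 2 / (1 + x / √6) ^ 2 / √6 * (1 + x / √6) ^ 2 := by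
        field_simp
    _ ≤ amplitude N M τ a V C L μ R ^ 2 / √t * (1 + x / √t) ^ 2 := by
        gcongr

end AlgorithmConstants

/-! ### Averaged iterates, consensus rate and the induction along the envelope -/

section Main

/-- A coordinate bounded by V has second moment 1. -/
lemma Perturbation.one_le {N M : ℕ} {Ω : Type*} {mΩ : MeasurableSpace Ω} {P : Measure Ω}
    [IsProbabilityMeasure P] {V : ℝ} {ν : Fin N → ℕ → Ω → Vec M} (hp : Perturbation P V ν)
    (i : Fin N) (m : Fin M) : 1 ≤ V := by
  have hV : 0 ≤ V := by
    obtain ⟨ω⟩ : Nonempty Ω := nonempty_of_isProbabilityMeasure P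
    exact (abs_nonneg _).trans (hp.abs_le i 1 le_rfl ω m)
  have h1 : ∫ ω, ν i 1 ω m * ν i 1 ω m ∂P = 1 := by simpa using hp.covariance i 1 le_rfl m m
  have hle : ∀ ω, ν i 1 ω m * ν i 1 ω m ≤ V ^ 2 := fun ω => by
    rw [← sq, ← sq_abs]
    exact pow_le_pow_left₀ (abs_nonneg _) (hp.abs_le i 1 le_rfl ω m) 2
  have hm := measurable_apply (hp.measurable i 1) m
  have hint : Integrable (fun ω => ν i 1 ω m * ν i 1 ω m) P :=
    integrable_of_bounded (hm.mul hm) (B := V ^ 2) fun ω => by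
      rw [abs_of_nonneg (mul_self_nonneg _)]; exact hle ω
  have h2 := integral_mono hint (integrable_const (V ^ 2)) hle
  rw [h1] at h2
  simp at h2
  rwa [abs_of_nonneg hV] at h2

lemma hasGradientWithinAt_globalCost {N M : ℕ} {S : Fin N → Type*} [∀ i, MeasurableSpace (S i)]
    {F : ∀ i, Vec M → S i → ℝ} {D : ∀ i, Measure (S i)} {K : Set (Vec M)}
    {g : Fin N → Vec M → Vec M} {x : Vec M}
    (hg : ∀ i, HasGradientWithinAt (localCost (F i) (D i)) (g i x) K x) :
    HasGradientWithinAt (globalCost F D) (mean fun i => g i x) K x := by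
  rw [hasGradientWithinAt_iff_hasFDerivWithinAt]
  have h1 := (HasFDerivWithinAt.fun_sum (u := Finset.univ)
    fun i _ => (hg i).hasFDerivWithinAt).const_mul (1 / N : ℝ)
  have e1 : globalCost F D = fun y => (1 / N : ℝ) * ∑ i, localCost (F i) (D i) y := by
    funext y; rw [globalCost]; ring
  rw [e1]
  refine h1.congr_fderiv ?_
  ext v
  simp [mean]

lemma norm_mean_sub_mean_le {N : ℕ} {E : Type*} [NormedAddCommGroup E] [InnerProductSpace ℝ E]
    {K : Set E} {g : Fin N → E → E} {Li : Fin N → ℝ} {L : ℝ} (hL : L = (∑ i, Li i) / N)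
    (hg : ∀ i, ∀ x ∈ K, ∀ y ∈ K, ‖g i x - g i y‖ ≤ Li i * ‖x - y‖) {x y : E} (hx : x ∈ K)
    (hy : y ∈ K) : ‖(mean fun i => g i x) - mean fun i => g i y‖ ≤ L * ‖x - y‖ := by
  rw [mean, mean, ← smul_sub, ← Finset.sum_sub_distrib, norm_smul, Real.norm_of_nonneg (by positivity)]
  calc 1 / (N : ℝ) * ‖∑ i, (g i x - g i y)‖ ≤ 1 / (N : ℝ) * ∑ i, Li i * ‖x - y‖ :=
        mul_le_mul_of_nonneg_left ((norm_sum_le _ _).trans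
          (Finset.sum_le_sum fun i _ => hg i x hx y hy)) (by positivity)
    _ = L * ‖x - y‖ := by rw [← Finset.sum_mul, hL]; ring

/-- Cauchy–Schwarz over the NT pairs of times and nodes. -/
lemma norm_average_sub_sq_le {N M : ℕ} {Ω : Type*} (hN : N ≠ 0) {T : ℕ} (hT : 1 ≤ T)
    (θ : Fin N → ℕ → Ω → Vec M) (z : Vec M) (ω : Ω) :
    ‖average θ T ω - z‖ ^ 2
      ≤ ((N : ℝ) * T)⁻¹ * ∑ t ∈ Finset.Icc 1 T, ∑ i, ‖θ i t ω - z‖ ^ 2 := by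
  have hN' : (0 : ℝ) < N := by exact_mod_cast Nat.pos_of_ne_zero hN
  have hT' : (0 : ℝ) < T := by exact_mod_cast hT
  have e1 : average θ T ω - z
      = ((N : ℝ) * T)⁻¹ • ∑ p ∈ Finset.Icc 1 T ×ˢ (Finset.univ : Finset (Fin N)),
          (θ p.2 p.1 ω - z) := by
    rw [Finset.sum_sub_distrib, smul_sub, Finset.sum_product, average, Finset.sum_const,
      Finset.card_product, Nat.card_Icc, Finset.card_univ, Fintype.card_fin,
      ← Nat.cast_smul_eq_nsmul ℝ, smul_smul]
    have : ((N : ℝ) * T)⁻¹ * (((T + 1 - 1) * N : ℕ) : ℝ) = 1 := by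
      rw [Nat.add_sub_cancel]; push_cast; field_simp
    rw [this, one_smul]
  rw [e1, norm_smul, mul_pow, Real.norm_of_nonneg (by positivity)]
  have h1 : ‖∑ p ∈ Finset.Icc 1 T ×ˢ (Finset.univ : Finset (Fin N)), (θ p.2 p.1 ω - z)‖ ^ 2
      ≤ ((N : ℝ) * T) * ∑ t ∈ Finset.Icc 1 T, ∑ i, ‖θ i t ω - z‖ ^ 2 := by
    refine (pow_le_pow_left₀ (norm_nonneg _) (norm_sum_le _ _) 2).trans ?_
    refine (sq_sum_le_card_mul_sum_sq).trans (le_of_eq ?_)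
    rw [Finset.sum_product, Finset.card_product]
    simp [mul_comm]
  calc _ ≤ ((N : ℝ) * T)⁻¹ ^ 2 * (((N : ℝ) * T) * ∑ t ∈ Finset.Icc 1 T, ∑ i, ‖θ i t ω - z‖ ^ 2) :=
        mul_le_mul_of_nonneg_left h1 (by positivity)
    _ = _ := by field_simp

lemma average_mem {N M : ℕ} {Ω : Type*} (hN : N ≠ 0) {T : ℕ} (hT : 1 ≤ T) {K : Set (Vec M)}
    (hK : Convex ℝ K) {θ : Fin N → ℕ → Ω → Vec M} {ω : Ω}
    (hθ : ∀ i t, 1 ≤ t → θ i t ω ∈ K) : average θ T ω ∈ K := by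
  have hN' : (N : ℝ) ≠ 0 := by exact_mod_cast hN
  have hT' : (T : ℝ) ≠ 0 := by exact_mod_cast (by omega : T ≠ 0)
  have e1 : average θ T ω = ∑ t ∈ Finset.Icc 1 T, (1 / T : ℝ) • mean fun i => θ i t ω := by
    rw [average, Finset.smul_sum]
    refine Finset.sum_congr rfl fun t _ => ?_
    rw [mean, smul_smul]
    congr 1
    field_simp
  rw [e1]
  refine hK.sum_mem (fun _ _ => by positivity) ?_ fun t ht =>
    mean_mem hN hK fun i => hθ i t (Finset.mem_Icc.1 ht).1
  simp [hT']

variable {N M τ : ℕ} {a V C L μ R : ℝ} {A : ℕ → Matrix (Fin N) (Fin N) ℝ} {K : Set (Vec M)}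
  {Ω : Type*} {S : Fin N → Type*} {F : ∀ i, Vec M → S i → ℝ} {ν : Fin N → ℕ → Ω → Vec M}
  {ξ : ∀ i, ℕ → Ω → S i} {θ : Fin N → ℕ → Ω → Vec M}

/-- The nodes agree up to an error of order `α_t / β_t`. -/
lemma IsRun.norm_sub_mean_le (h : IsRun A K V (alpha μ) (beta N M τ a V C L) F ν ξ θ)
    (hA : Network A a τ) (hN : 2 ≤ N) (hM : 1 ≤ M) (hτ : 1 ≤ τ) (ha : 0 < a) (hV : 1 ≤ V)
    (hC : 0 < C) (hL : 0 < L) (hμ : 0 < μ) (hK : Convex ℝ K)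
    (h0 : (0 : Vec M) ∈ shrink K V (beta N M τ a V C L 1))
    (hFC : ∀ i, ∀ x ∈ K, ∀ s, |F i x s| ≤ C) (hνV : ∀ i t, 1 ≤ t → ∀ ω m, |ν i t ω m| ≤ V)
    {t : ℕ} (ht : 1 ≤ t) (i : Fin N) (ω : Ω) :
    ‖θ i t ω - mean fun j => θ j t ω‖
      ≤ kappa N τ a / 2 * (√M * V * C * (alpha μ t / beta N M τ a V C L t)) := by
  obtain ⟨n, rfl⟩ := Nat.exists_eq_add_of_le' ht
  have ha' := hA.weight_le_half hN
  have hb0 := beta0_pos (τ := τ) (a := a) hN hM hV hL hC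
  have hη := eta_pos hN hτ ha ha'
  have hη' := eta_lt_one hN hτ ha ha'
  have hρ := one_le_rho_half hN hτ ha ha'
  refine (h.norm_sub_mean_le_sum hA hN hτ ha hK h0 (by linarith) hFC hνV
    (fun t ht => (alpha_pos hμ ht).le) (fun t ht => beta_pos hb0 ht)
    (fun t ht => beta_anti hb0 ht (Nat.le_succ t)) n i ω).trans ?_
  set G := √M * V * C * (3 / (μ * beta0 N M τ a V C L)) with hG
  have hV0 : 0 < V := by linarith
  have hG0 : 0 ≤ G := by positivity
  have e1 : ∀ s ∈ Finset.range n, eta N τ a ^ (n - 1 - s)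
      * (√M * V * C * (alpha μ (s + 1) / beta N M τ a V C L (s + 1)))
      = G * (eta N τ a ^ (n - 1 - s) * ((s + 1 : ℕ) : ℝ) ^ (-(3 / 4) : ℝ)) := fun s _ => by
    rw [alpha_div_beta hb0 hμ (by omega), hG]; ring
  rw [Finset.sum_congr rfl e1, ← Finset.mul_sum, alpha_div_beta hb0 hμ ht]
  have h1 := sum_geometric_mul_rpow_le hη.le hη' n
  have h2 := mul_rho_le_kappa hN hτ ha ha'
  calc N * (rho N τ a / 2) * (G * ∑ s ∈ Finset.range n,
        eta N τ a ^ (n - 1 - s) * ((s + 1 : ℕ) : ℝ) ^ (-(3 / 4) : ℝ))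
      ≤ N * (rho N τ a / 2) * (G * ((7 - 4 * eta N τ a) / (4 * (1 - eta N τ a) ^ 2)
          * ((n + 1 : ℕ) : ℝ) ^ (-(3 / 4) : ℝ))) := by gcongr
    _ = N * (rho N τ a / 2) * ((7 - 4 * eta N τ a) / (4 * (1 - eta N τ a) ^ 2))
          * (G * ((n + 1 : ℕ) : ℝ) ^ (-(3 / 4) : ℝ)) := by ring
    _ ≤ kappa N τ a / 2 * (G * ((n + 1 : ℕ) : ℝ) ^ (-(3 / 4) : ℝ)) :=
        mul_le_mul_of_nonneg_right h2 (by positivity)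
    _ = _ := by rw [hG]; ring

variable {mΩ : MeasurableSpace Ω} {P : Measure Ω} [IsProbabilityMeasure P]
  [∀ i, MeasurableSpace (S i)] {D : ∀ i, Measure (S i)}

/-- The expected squared distance to the minimizer stays below the envelope. -/
lemma IsRun.meanSqDist_le_envelope
    (h : IsRun A K V (alpha μ) (beta N M τ a V C L) F ν ξ θ)
    (hA : Network A a τ) (hN : 2 ≤ N) (hM : 1 ≤ M) (hτ : 1 ≤ τ) (ha : 0 < a) (hV : 1 ≤ V)
    (hC : 0 < C) (hL : 0 < L) (hμ : 0 < μ) (hK : Feasible K R)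
    (h0 : (0 : Vec M) ∈ shrink K V (beta0 N M τ a V C L))
    (hF : ∀ i, Measurable fun p : K × S i => F i p.1 p.2)
    (hFC : ∀ i, ∀ x ∈ K, ∀ s, |F i x s| ≤ C)
    (hp : Perturbation P V ν) (hs : Sampling P D ν ξ) {g : Fin N → Vec M → Vec M}
    (hg : ∀ i, ∀ x ∈ K, HasGradientWithinAt (localCost (F i) (D i)) (g i x) K x)
    {Li : Fin N → ℝ} (hLi : ∀ i, 0 ≤ Li i)
    (hgL : ∀ i, ∀ x ∈ K, ∀ y ∈ K, ‖g i x - g i y‖ ≤ Li i * ‖x - y‖)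
    (hLLi : L = (∑ i, Li i) / N) {z : Vec M} (hz : z ∈ shrink K V (beta0 N M τ a V C L))
    (hmono : ∀ x ∈ K, μ * ‖x - z‖ ^ 2 ≤ ⟪x - z, mean fun i => g i x⟫) {t : ℕ} (ht : 1 ≤ t) :
    meanSqDist P θ z t
      ≤ envelope (amplitude N M τ a V C L μ R) (ratio N M τ a V C L μ) t := by
  have ha' := hA.weight_le_half hN
  have hV0 : 0 ≤ V := by linarith
  have hN0 : N ≠ 0 := by omega
  have hb0 := beta0_pos (τ := τ) (a := a) hN hM hV hL hC
  have hzK : z ∈ K := shrink_subset hV0 _ hz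
  rw [← beta_one] at h0
  have hl3 := lamIII_pos (τ := τ) (a := a) hN hM hV hC
  have hx0 : 0 ≤ ratio N M τ a V C L μ := by
    have := lamII_nonneg (M := M) hN hτ ha ha' hV hL hC
    unfold ratio; positivity
  have hw0 : 0 ≤ amplitude N M τ a V C L μ R := by
    have := lamI_pos hN hM hV hL
    unfold amplitude; positivity
  have hsmall : ∀ t, 1 ≤ t → t ≤ 6 → meanSqDist P θ z t
      ≤ envelope (amplitude N M τ a V C L μ R) (ratio N M τ a V C L μ) t := fun t ht ht6 => by
    refine le_trans ?_ (diameter_le_envelope hN hM hτ ha ha' hV hL hC hμ ht ht6)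
    have hθm := h.measurable hK.convex h0 hF hp hs ht
    have hb : ∀ i ω, ‖θ i t ω - z‖ ≤ 2 * R := fun i ω =>
      hK.norm_sub_le (h.mem h0 hV0 ht i ω) hzK
    have h1 := integral_mono (μ := P)
      (integrable_finsetSum Finset.univ fun i _ => integrable_norm_sq (hθm i) (hb i))
      (integrable_const (4 * N * R ^ 2)) fun ω => by
        refine (Finset.sum_le_sum fun i _ =>
          pow_le_pow_left₀ (norm_nonneg _) (hb i ω) 2).trans_eq ?_
        simp; ring
    simpa [meanSqDist] using h1
  induction t, ht using Nat.le_induction with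
  | base => exact hsmall 1 le_rfl (by norm_num)
  | succ t ht ih =>
    -- The recursion is used only from t = 6 on, where 2α_tμ = 6/t ≤ 1; before that the diameter of
    -- K decides.
    by_cases ht6 : t + 1 ≤ 6
    · exact hsmall _ (by omega) ht6
    have ht6' : 6 ≤ t := by omega
    have htr : (6 : ℝ) ≤ t := by exact_mod_cast ht6'
    have ht0 : (0 : ℝ) < t := by linarith
    have hq2 : √(t : ℝ) ^ 2 = t := Real.sq_sqrt ht0.le
    have hzs : z ∈ shrink K V (beta N M τ a V C L (t + 1)) := by
      refine shrink_anti (beta_pos hb0 (by omega)).le ?_ hz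
      rw [← beta_one]
      exact beta_anti hb0 le_rfl (by omega)
    have hrec := h.meanSqDist_succ_le hN0 hA hK h0 hV0 hF hFC hp hs hg hLi hgL hμ.le hLLi hzK hmono
      ht (alpha_pos hμ ht).le (beta_pos hb0 ht) hzs
      (h.norm_sub_mean_le hA hN hM hτ ha hV hC hL hμ hK.convex h0 hFC hp.abs_le ht) rfl
    have he := h.sq_integral_norm_mean_sub_le hN0 hK h0 hV0 hF hp hs ht hzK
    have hαμ : 2 * alpha μ t * μ ≤ 1 := by
      have : 2 * alpha μ t * μ = 6 / t := by rw [alpha]; field_simp; norm_num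
      rw [this, div_le_one ht0]; exact htr
    have hrec' := recursion_constants hN hV hL hC (two_le_kappa hN hτ ha ha') (alpha_pos hμ ht)
      (beta_pos hb0 ht) hαμ he rfl rfl hrec
    refine envelope_step_of_recursion (lamI_pos hN hM hV hL) hμ hb0 hw0 hx0
      (p := (t : ℝ) ^ (-(1 / 4) : ℝ)) (q := √(t : ℝ)) (by positivity) ?_ (by rw [hq2]; exact htr)
      (Real.sqrt_pos.2 ht0) (Real.sqrt_pos.2 (by positivity)) ?_
      (beta0_pow_four hN hM hV hL hC) (lamII_eq_ratio hN hM hV hL hC hμ)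
      (lamI_mul_beta0_le hN hM hV hL hC hμ) ?_ rfl ih hrec'
    · rw [Real.sqrt_eq_rpow, ← Real.rpow_natCast, ← Real.rpow_mul ht0.le, ← Real.rpow_add ht0]
      norm_num
    · rw [hq2, Real.sq_sqrt (by positivity)]; push_cast; ring
    · rw [hq2, alpha]; ring

end Main

/-! ### The rate -/

section Rate

variable {N M τ : ℕ} {a V C L μ R : ℝ}

lemma lamI_scale : lamI N M V L = M * √M * lamI N 1 V L := by
  rw [lamI_eq, lamI_eq]; simp; ring

lemma lamII_scale : lamII N M τ a V C L = √M * lamII N 1 τ a V C L := by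
  rw [lamII_eq, lamII_eq]; simp; ring

lemma lamIII_scale : lamIII N M τ a V C = M * lamIII N 1 τ a V C := by
  rw [lamIII, lamIII]; simp; ring

/-- λ_II and √λ_III both scale like √M, so the shape parameter of the envelope does not see the
dimension. -/
lemma ratio_scale (hM : 1 ≤ M) : ratio N M τ a V C L μ = ratio N 1 τ a V C L μ := by
  have hM' : (0 : ℝ) < M := by exact_mod_cast hM
  have h1 : 0 < √(M : ℝ) := Real.sqrt_pos.2 hM'
  rw [ratio, ratio, lamII_scale (M := M), lamIII_scale (M := M), mul_left_comm 6 (M : ℝ),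
    Real.sqrt_mul hM'.le]
  rw [mul_left_comm μ, mul_div_mul_left _ _ h1.ne']

lemma ratio_sq (hN : 2 ≤ N) (hM : 1 ≤ M) (hV : 1 ≤ V) (hC : 0 < C) (hμ : 0 < μ) :
    lamII N M τ a V C L ^ 2 / (4 * μ ^ 2 * lamIII N M τ a V C)
      = 3 / 2 * ratio N M τ a V C L μ ^ 2 := by
  have h2 := lamIII_pos (τ := τ) (a := a) hN hM hV hC
  rw [ratio, div_pow, mul_pow, Real.sq_sqrt (by positivity)]
  field_simp
  ring

lemma errorBound_eq (hN : 2 ≤ N) (hM : 1 ≤ M) (hV : 1 ≤ V) (hC : 0 < C) (hL : 0 < L) (hμ : 0 < μ)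
    (T : ℕ) : errorBound N M τ a V C L μ R T
      = L / N * amplitude N M τ a V C L μ R ^ 2 * (1 / √T
        + ratio N M τ a V C L μ * (Real.log T / T)
        + (ratio N M τ a V C L μ + 3 / 2 * ratio N M τ a V C L μ ^ 2) * (1 / T)) := by
  rw [errorBound, ratio_sq hN hM hV hC hμ, amplitude_sq hV hL, ratio]
  ring

/-- The only loss is in summing the envelope: the explicit bound is exactly L/(2NT) times the
estimate of `sum_envelope_le`. -/
lemma sum_envelope_le_errorBound (hN : 2 ≤ N) (hM : 1 ≤ M) (hτ : 1 ≤ τ) (ha : 0 < a)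
    (ha' : a ≤ 1 / 2) (hV : 1 ≤ V) (hC : 0 < C) (hL : 0 < L) (hμ : 0 < μ) {T : ℕ} (hT : 1 ≤ T) :
    L / 2 * (((N : ℝ) * T)⁻¹ * ∑ t ∈ Finset.Icc 1 T,
        envelope (amplitude N M τ a V C L μ R) (ratio N M τ a V C L μ) t)
      ≤ errorBound N M τ a V C L μ R T := by
  have hl3 := lamIII_pos (τ := τ) (a := a) hN hM hV hC
  have hx0 : 0 ≤ ratio N M τ a V C L μ := by
    have := lamII_nonneg (M := M) hN hτ ha ha' hV hL hC
    unfold ratio; positivity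
  have hT0 : (0 : ℝ) < T := by exact_mod_cast hT
  have hN0 : (0 : ℝ) < N := by exact_mod_cast (by omega : 0 < N)
  have hs : √(T : ℝ) ^ 2 = T := Real.sq_sqrt hT0.le
  have hs0 : 0 < √(T : ℝ) := Real.sqrt_pos.2 hT0
  have h1 := sum_envelope_le (w := amplitude N M τ a V C L μ R) hx0 hT
  have h2 : 0 ≤ L / 2 * ((N : ℝ) * T)⁻¹ := by positivity
  have h3 := mul_le_mul_of_nonneg_left h1 h2
  rw [← mul_assoc]
  refine h3.trans_eq ?_
  rw [errorBound_eq hN hM hV hC hL hμ]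
  have e : 1 / √(T : ℝ) = √(T : ℝ) / T := by
    rw [div_eq_div_iff hs0.ne' hT0.ne', one_mul, ← sq, hs]
  rw [e]
  field_simp
  ring

/-- Multiplied by λ_I², the first argument of the maximum is at most 4√6 N R², whatever M, while the
second is √(6λ_III)λ_I/μ², of order √M · M^{3/2} = M². -/
lemma amplitude_sq_le (hN : 2 ≤ N) (hM : 1 ≤ M) (hτ : 1 ≤ τ) (ha : 0 < a) (ha' : a ≤ 1 / 2)
    (hV : 1 ≤ V) (hC : 0 < C) (hL : 0 < L) (hμ : 0 < μ) :
    amplitude N M τ a V C L μ R ^ 2 ≤ (M : ℝ) ^ 2 * (4 * √6 * N * R ^ 2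
      + √(6 * lamIII N 1 τ a V C) * lamI N 1 V L / μ ^ 2) := by
  have hM' : (1 : ℝ) ≤ M := by exact_mod_cast hM
  have h1 := lamI_pos hN hM hV hL
  have h11 := lamI_pos hN le_rfl hV hL
  have h2 : 0 ≤ lamII N M τ a V C L := lamII_nonneg hN hτ ha ha' hV hL hC
  rw [amplitude_sq hV hL, PsiStar, max_mul_of_nonneg _ _ (sq_nonneg _)]
  have hM2 : (1 : ℝ) ≤ (M : ℝ) ^ 2 := one_le_pow₀ hM'
  refine max_le ?_ ?_
  · set X := lamI N M V L * lamII N M τ a V C L / (6 * μ * √(lamIII N M τ a V C)) with hX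
    have hX0 : 0 ≤ X := by positivity
    have h3 : ((lamI N M V L + X) ^ 2)⁻¹ * lamI N M V L ^ 2 ≤ 1 := by
      rw [inv_mul_le_iff₀ (by positivity), mul_one]
      exact pow_le_pow_left₀ h1.le (by linarith) 2
    calc _ = 4 * √6 * N * R ^ 2 * (((lamI N M V L + X) ^ 2)⁻¹ * lamI N M V L ^ 2) := by ring
      _ ≤ 4 * √6 * N * R ^ 2 * 1 := mul_le_mul_of_nonneg_left h3 (by positivity)
      _ ≤ 1 * (4 * √6 * N * R ^ 2 + √(6 * lamIII N 1 τ a V C) * lamI N 1 V L / μ ^ 2) := by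
          rw [mul_one, one_mul]
          exact le_add_of_nonneg_right (by positivity)
      _ ≤ _ := mul_le_mul_of_nonneg_right hM2 (by positivity)
  · have e : √(6 * lamIII N M τ a V C) / (lamI N M V L * μ ^ 2) * lamI N M V L ^ 2
        = (M : ℝ) ^ 2 * (√(6 * lamIII N 1 τ a V C) * lamI N 1 V L / μ ^ 2) := by
      have e1 : √(6 * lamIII N M τ a V C) / (lamI N M V L * μ ^ 2) * lamI N M V L ^ 2
          = √(6 * lamIII N M τ a V C) * lamI N M V L / μ ^ 2 := by field_simp
      have hs : √(M : ℝ) * √(M : ℝ) = M := Real.mul_self_sqrt (by positivity)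
      rw [e1, lamI_scale (M := M), lamIII_scale (M := M), mul_left_comm 6 (M : ℝ),
        Real.sqrt_mul (by positivity)]
      calc _ = (√(M : ℝ) * √(M : ℝ)) * M * (√(6 * lamIII N 1 τ a V C) * lamI N 1 V L / μ ^ 2) := by
            ring
        _ = _ := by rw [hs]; ring
    rw [e]
    refine mul_le_mul_of_nonneg_left ?_ (by positivity)
    exact le_add_of_nonneg_left (by positivity)

/-- The constant of the rate `O(M² T^{-1/2})`. -/
def rateConstant (N τ : ℕ) (a V C L μ R : ℝ) : ℝ :=
  L / N * (4 * √6 * N * R ^ 2 + √(6 * lamIII N 1 τ a V C) * lamI N 1 V L / μ ^ 2)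
    * (1 + 3 * ratio N 1 τ a V C L μ + 3 / 2 * ratio N 1 τ a V C L μ ^ 2)

lemma errorBound_le_rate (hN : 2 ≤ N) (hM : 1 ≤ M) (hτ : 1 ≤ τ) (ha : 0 < a) (ha' : a ≤ 1 / 2)
    (hV : 1 ≤ V) (hC : 0 < C) (hL : 0 < L) (hμ : 0 < μ) {T : ℕ} (hT : 1 ≤ T) :
    errorBound N M τ a V C L μ R T
      ≤ rateConstant N τ a V C L μ R * ((M : ℝ) ^ 2 * (T : ℝ) ^ (-(1 / 2) : ℝ)) := by
  have hx0 : 0 ≤ ratio N 1 τ a V C L μ := by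
    have := lamII_nonneg (M := 1) hN hτ ha ha' hV hL hC
    unfold ratio; positivity
  have hT1 : (1 : ℝ) ≤ T := by exact_mod_cast hT
  have hT0 : (0 : ℝ) < T := by linarith
  have hs : √(T : ℝ) ^ 2 = T := Real.sq_sqrt hT0.le
  have hs0 : 0 < √(T : ℝ) := Real.sqrt_pos.2 hT0
  have hs1 : 1 ≤ √(T : ℝ) := Real.one_le_sqrt.2 hT1
  have hlog : Real.log T ≤ 2 * √(T : ℝ) := by
    have h1 : Real.log T = 2 * Real.log √(T : ℝ) := by rw [Real.log_sqrt hT0.le]; ring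
    rw [h1]
    linarith [Real.log_le_sub_one_of_pos hs0]
  have hrp : (T : ℝ) ^ (-(1 / 2) : ℝ) = 1 / √(T : ℝ) := by
    rw [Real.rpow_neg hT0.le, ← Real.sqrt_eq_rpow, one_div]
  have e : 1 / √(T : ℝ) = √(T : ℝ) / T := by
    rw [div_eq_div_iff hs0.ne' hT0.ne', one_mul, ← sq, hs]
  rw [errorBound_eq hN hM hV hC hL hμ, ratio_scale hM, hrp, rateConstant]
  set x := ratio N 1 τ a V C L μ with hx
  -- The coefficient 3x is 2x from log T ≤ 2√T plus x from 1/T ≤ 1/√T.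
  have hbr : 1 / √(T : ℝ) + x * (Real.log T / T) + (x + 3 / 2 * x ^ 2) * (1 / T)
      ≤ (1 + 3 * x + 3 / 2 * x ^ 2) * (1 / √(T : ℝ)) := by
    have h1 : Real.log T / T ≤ 2 * (1 / √(T : ℝ)) := by
      rw [e, ← mul_div_assoc]; exact div_le_div_of_nonneg_right hlog hT0.le
    have h2 : 1 / (T : ℝ) ≤ 1 / √(T : ℝ) := by
      rw [e]; exact div_le_div_of_nonneg_right hs1 hT0.le
    have h3 := mul_le_mul_of_nonneg_left h1 hx0
    have h4 := mul_le_mul_of_nonneg_left h2 (by positivity : 0 ≤ x + 3 / 2 * x ^ 2)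
    linarith
  have hamp := amplitude_sq_le (R := R) hN hM hτ ha ha' hV hC hL hμ
  have h11 := lamI_pos hN le_rfl hV hL
  have hlog0 : 0 ≤ Real.log T := Real.log_nonneg hT1
  have hLN : 0 ≤ L / N := by positivity
  calc _ ≤ L / N * ((M : ℝ) ^ 2 * (4 * √6 * N * R ^ 2
        + √(6 * lamIII N 1 τ a V C) * lamI N 1 V L / μ ^ 2))
        * ((1 + 3 * x + 3 / 2 * x ^ 2) * (1 / √(T : ℝ))) :=
        mul_le_mul (mul_le_mul_of_nonneg_left hamp hLN) hbr (by positivity) (by positivity)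
    _ = _ := by ring

end Rate

end DZOSCO
end

/-! ### Assembly of the theorem -/

open DZOSCO
theorem theorem4 (N τ : ℕ) (hN : 2 ≤ N) (hτ : 1 ≤ τ) (a V C L μ R : ℝ)
    (ha : 0 < a) (hC : 0 < C) (hL : 0 < L) (hμ : 0 < μ) :
    ∃ c : ℝ, ∀ (M : ℕ) (_ : 1 ≤ M)
      (A : ℕ → Matrix (Fin N) (Fin N) ℝ) (_ : DZOSCO.Network A a τ)
      (K : Set (DZOSCO.Vec M)) (_ : DZOSCO.Feasible K R)
      (S : Fin N → Type*) [∀ i, MeasurableSpace (S i)]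
      (F : ∀ i, DZOSCO.Vec M → S i → ℝ)
      (_ : ∀ i, Measurable (fun p : K × S i => F i p.1 p.2))
      (_ : ∀ i, ∀ θ ∈ K, ∀ s, |F i θ s| ≤ C)
      (D : ∀ i, Measure (S i))
      (_ : StrongConvexOn K μ (DZOSCO.globalCost F D))
      (Li : Fin N → ℝ) (_ : ∀ i, DZOSCO.SmoothOn (DZOSCO.localCost (F i) (D i)) K (Li i))
      (_ : L = (∑ i, Li i) / N)
      (θstar : DZOSCO.Vec M)
      (_ : IsMinOn (DZOSCO.globalCost F D) K θstar)
      (_ : θstar ∈ DZOSCO.shrink K V (DZOSCO.beta0 N M τ a V C L))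
      (_ : (0 : DZOSCO.Vec M) ∈ DZOSCO.shrink K V (DZOSCO.beta0 N M τ a V C L))
      (Ω : Type*) [MeasurableSpace Ω] (P : Measure Ω) [IsProbabilityMeasure P]
      (ν : Fin N → ℕ → Ω → DZOSCO.Vec M) (_ : DZOSCO.Perturbation P V ν)
      (ξ : ∀ i, ℕ → Ω → S i) (_ : DZOSCO.Sampling P D ν ξ)
      (θ : Fin N → ℕ → Ω → DZOSCO.Vec M)
      (_ : DZOSCO.IsRun A K V (DZOSCO.alpha μ) (DZOSCO.beta N M τ a V C L) F ν ξ θ)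
      (T : ℕ) (_ : 1 ≤ T),
      Integrable (fun ω => DZOSCO.globalCost F D (DZOSCO.average θ T ω)
          - DZOSCO.globalCost F D θstar) P ∧
      ∫ ω, (DZOSCO.globalCost F D (DZOSCO.average θ T ω) - DZOSCO.globalCost F D θstar) ∂P
          ≤ DZOSCO.errorBound N M τ a V C L μ R T ∧
      DZOSCO.errorBound N M τ a V C L μ R T ≤ c * ((M : ℝ) ^ 2 * (T : ℝ) ^ (-(1 / 2) : ℝ)) := by
  refine ⟨rateConstant N τ a V C L μ R, ?_⟩
  intro M hM A hA K hK S _ F hF hFC D hconv Li hsmooth hLLi z hmin hz h0 Ω _ P _ ν hp ξ hs θ h T hT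
  have ha' := hA.weight_le_half hN
  have hN0 : N ≠ 0 := by omega
  have hV : 1 ≤ V := hp.one_le ⟨0, by omega⟩ ⟨0, by omega⟩
  have hV0 : 0 ≤ V := by linarith
  have hb0 := beta0_pos (τ := τ) (a := a) hN hM hV hL hC
  have hzK : z ∈ K := shrink_subset hV0 _ hz
  choose g hg hgL using hsmooth
  -- K contains the distinct points 0 and β₀(V, …, V), and the Lipschitz inequality between them
  -- forces L_i ≥ 0.
  have hLi : ∀ i, 0 ≤ Li i := fun i => by
    let v : Vec M := WithLp.toLp 2 fun _ => V
    have hv : v ≠ 0 := fun hv => by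
      have : v ⟨0, by omega⟩ = 0 := by rw [hv]; rfl
      have : V = 0 := this
      linarith
    have hx := h0 v fun m => (abs_of_nonneg hV0).le
    rw [zero_add] at hx
    have h1 := (norm_nonneg _).trans (hgL i _ hx 0 hK.zero_mem)
    rw [sub_zero] at h1
    exact nonneg_of_mul_nonneg_left h1 (norm_pos_iff.2 (smul_ne_zero hb0.ne' hv))
  have hG : ∀ x ∈ K, HasGradientWithinAt (globalCost F D) (mean fun i => g i x) K x :=
    fun x hx => hasGradientWithinAt_globalCost fun i => hg i x hx
  have hGz : (mean fun i => g i z) = 0 :=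
    gradient_eq_zero_of_isMinOn (g := fun x => mean fun i => g i x)
      (mem_nhds_of_mem_shrink (by linarith) hb0 hz) hmin (hG z hzK)
  have hmono : ∀ x ∈ K, μ * ‖x - z‖ ^ 2 ≤ inner ℝ (x - z) (mean fun i => g i x) := fun x hx =>
    StrongConvexOn.le_inner_of_isMinOn (g := fun x => mean fun i => g i x) hconv hG hx hzK hGz
  -- With vanishing gradient at z, the Taylor estimate makes the optimality gap quadratic in the
  -- distance.
  have hup : ∀ x ∈ K, |globalCost F D x - globalCost F D z| ≤ L / 2 * ‖x - z‖ ^ 2 := fun x hx => by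
    have h1 := abs_sub_sub_inner_le (g := fun x => mean fun i => g i x) (L := L) hK.convex hG
      (fun x hx y hy => norm_mean_sub_mean_le hLLi hgL hx hy) hzK hx
    simpa [hGz] using h1
  have h0' : (0 : Vec M) ∈ shrink K V (beta N M τ a V C L 1) := by rw [beta_one]; exact h0
  have hmem : ∀ ω i t, 1 ≤ t → θ i t ω ∈ K := fun ω i t ht => h.mem h0' hV0 ht i ω
  have hθm : ∀ i t, 1 ≤ t → Measurable (θ i t) := fun i t ht =>
    h.measurable hK.convex h0' hF hp hs ht i
  have havg : ∀ ω, DZOSCO.average θ T ω ∈ K := fun ω => average_mem hN0 hT hK.convex (hmem ω)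
  have havgm : Measurable (DZOSCO.average θ T) := by
    unfold DZOSCO.average
    exact (Finset.measurable_fun_sum _ fun t ht => Finset.measurable_fun_sum _ fun i _ =>
      hθm i t (Finset.mem_Icc.1 ht).1).fun_const_smul _
  have hcont : ContinuousOn (globalCost F D) K := fun x hx =>
    (hG x hx).hasFDerivWithinAt.continuousWithinAt
  have hint : Integrable (fun ω => globalCost F D (DZOSCO.average θ T ω) - globalCost F D z) P := by
    refine integrable_of_bounded
      ((measurable_comp_of_continuousOn hcont havgm havg).sub_const _)
      (B := L / 2 * (2 * R) ^ 2) fun ω => (hup _ (havg ω)).trans ?_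
    exact mul_le_mul_of_nonneg_left
      (pow_le_pow_left₀ (norm_nonneg _) (hK.norm_sub_le (havg ω) hzK) 2) (by positivity)
  refine ⟨hint, ?_, errorBound_le_rate hN hM hτ ha ha' hV hC hL hμ hT⟩
  refine le_trans ?_ (sum_envelope_le_errorBound hN hM hτ ha ha' hV hC hL hμ hT)
  have hi : ∀ t ∈ Finset.Icc 1 T, Integrable (fun ω => ∑ i, ‖θ i t ω - z‖ ^ 2) P := fun t ht =>
    integrable_finsetSum _ fun i _ => integrable_norm_sq (hθm i t (Finset.mem_Icc.1 ht).1) fun ω =>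
      hK.norm_sub_le (hmem ω i t (Finset.mem_Icc.1 ht).1) hzK
  calc ∫ ω, (globalCost F D (DZOSCO.average θ T ω) - globalCost F D z) ∂P
      ≤ ∫ ω, L / 2 * (((N : ℝ) * T)⁻¹ * ∑ t ∈ Finset.Icc 1 T, ∑ i, ‖θ i t ω - z‖ ^ 2) ∂P := by
        refine integral_mono hint (((integrable_finsetSum _ hi).const_mul _).const_mul _)
          fun ω => ?_
        exact (le_abs_self _).trans ((hup _ (havg ω)).trans
          (mul_le_mul_of_nonneg_left (norm_average_sub_sq_le hN0 hT θ z ω) (by positivity)))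
    _ = L / 2 * (((N : ℝ) * T)⁻¹ * ∑ t ∈ Finset.Icc 1 T, meanSqDist P θ z t) := by
        rw [integral_const_mul, integral_const_mul, integral_finsetSum _ hi]
        rfl
    _ ≤ _ := by
        refine mul_le_mul_of_nonneg_left (mul_le_mul_of_nonneg_left
          (Finset.sum_le_sum fun t ht => ?_) (by positivity)) (by positivity)
        exact h.meanSqDist_le_envelope hA hN hM hτ ha hV hC hL hμ hK h0 hF hFC hp hs hg hLi hgL
          hLLi hz hmono (Finset.mem_Icc.1 ht).1
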